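/- For $0\le k<1$ let $K(k)=\int_0^{\pi/2}\frac{d\theta}{\sqrt{1-k^2\sin^2\theta}}$. For complex $a_0,g_0$ and signs $\sigma_n\in\{1,-1\}$ $(n\ge 0)$ let $$a_{n+1}=\frac{a_n+g_n}{2},\qquad g_{n+1}=\sigma_n\sqrt{a_ng_n},$$ where $\sqrt{a_ng_n}$ is the root $r$ for which $r/(a_n+g_n)$ has positive real part and, if both roots are equally near to the arithmetic mean (that is, if $r/(a_n+g_n)$ is purely imaginary), the root with positive imaginary part (the positive root, should both be real). If both sequences converge to the same limit, it is denoted by $AGM_\sigma(a_0,g_0)$. For a number $x$ let $V(x)$ be the set of all values $\pi/(2\,AGM_\sigma(1,x))$, where $\sigma$ runs over the sign sequences with $\sigma_n=-1$ for only finitely many $n$ for which $AGM_\sigma(1,x)$ exists and is nonzero. Let $0<b<1$ and $k=\sqrt{1-b^2}$. Then: 1. If $b$ is replaced by $-b$, the first root is $\sqrt{-b}=\pm i\sqrt b$; with all later signs equal to $+1$, the limit exists, is nonzero, and $$\frac{\pi}{2\,AGM(1,-b)}=K(k)\mp 2iK(b),$$ where the upper (lower) sign belongs to the root $+i\sqrt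 b$ (respectively $-i\sqrt b$). 2. For every $\sigma$ with only finitely many $\sigma_n=-1$, both $AGM_\sigma(1,b)$ and $AGM_\sigma(1,-b)$ exist and are nonzero. 3. The values from $b$ lie on, and span, the lattice through $K(k)$ with parameters $4K(k)$ and $4iK(b)$; the values from $-b$ lie on, and span, the same lattice offset by $2iK(b)$. That is, the smallest translates of additive subgroups of $\mathbb C$ containing $V(b)$ and $V(-b)$ are, respectively, $$K(k)+4K(k)\mathbb Z+4iK(b)\mathbb Z\qquad\text{and}\qquad K(k)+2iK(b)+4K(k)\mathbb Z+4iK(b)\mathbb Z .$$ 4. The only element of smallest absolute value of $V(b)$ is $K(k)$, and the elements of smallest absolute value of $V(-b)$ are exactly $K(k)-2iK(b)$ and $K(k)+2iK(b)$. -/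

import Mathlib

open Filter Topology

noncomputable section

namespace MultivaluedAGM

/-- The complete elliptic integral of the first kind of modulus `k`,
`K(k) = ∫₀^{π/2} dθ / √(1 - k² sin² θ)`, for real `0 ≤ k < 1`. -/
def ellipticK (k : ℝ) : ℝ :=
  ∫ θ in (0 : ℝ)..(Real.pi / 2), 1 / Real.sqrt (1 - k ^ 2 * Real.sin θ ^ 2)

/-- The square root `r` of `a * g` that is nearer to the arithmetic mean of `a` and `g`, that is,
the one for which `r / (a + g)` has positive real part. If both roots are equally near, the one
with nonnegative imaginary part (if both roots are real, the nonnegative one) is taken. -/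
def nearRoot (a g : ℂ) : ℂ :=
  let r := (a * g) ^ (1 / 2 : ℂ)
  if 0 < (r / (a + g)).re then r
  else if (r / (a + g)).re < 0 then -r
  else if 0 ≤ r.im then r
  else -r

/-- The complex arithmetic-geometric iteration started at `(a, g)`, with sign choices `σ`:
`aₙ₊₁ = (aₙ + gₙ) / 2` and `gₙ₊₁ = σₙ √(aₙ gₙ)`, where `√` is the near root. -/
def agmSeq (σ : ℕ → ℤˣ) (a g : ℂ) : ℕ → ℂ × ℂ
  | 0 => (a, g)
  | n + 1 =>
    (((agmSeq σ a g n).1 + (agmSeq σ a g n).2) / 2,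
      ((σ n : ℤ) : ℂ) * nearRoot (agmSeq σ a g n).1 (agmSeq σ a g n).2)

/-- `M` is the arithmetic-geometric mean of `a` and `g` for the sign choices `σ`:
the common limit of both sequences. -/
def HasAGM (σ : ℕ → ℤˣ) (a g M : ℂ) : Prop :=
  Tendsto (fun n => (agmSeq σ a g n).1) atTop (𝓝 M) ∧
    Tendsto (fun n => (agmSeq σ a g n).2) atTop (𝓝 M)

/-- Only finitely many sign choices are `-1`. -/
def FinitelyManyFlips (σ : ℕ → ℤˣ) : Prop :=
  ∀ᶠ n in atTop, σ n = 1

/-- All the values of `π / (2 AGM(1, x))` obtained from finitely many nontrivial sign choices. -/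
def invAGMValues (x : ℂ) : Set ℂ :=
  {w | ∃ σ : ℕ → ℤˣ, FinitelyManyFlips σ ∧
    ∃ M : ℂ, M ≠ 0 ∧ HasAGM σ 1 x M ∧ w = (Real.pi : ℂ) / (2 * M)}

/-- The lattice through the point `z` with lattice parameters `ω₁` and `ω₂`. -/
def latticeThrough (z ω₁ ω₂ : ℂ) : Set ℂ :=
  {w | ∃ m n : ℤ, w = z + m * ω₁ + n * ω₂}

/-- The elements of smallest absolute value of a set of complex numbers. -/
def smallestElements (S : Set ℂ) : Set ℂ :=
  {w | w ∈ S ∧ ∀ z ∈ S, ‖w‖ ≤ ‖z‖}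

end MultivaluedAGM

end

/-!
The arithmetic-geometric step is the duplication of theta constants. If
`a = (π / 2u) θ₃(τ)²` and `g = (π / 2u) θ₄(τ)²` with `τ = v / u` in the upper half plane, then
`(a + g) / 2` and one square root of `a g` are the same expressions at `(u, 2v)`
(`IsPeriodBasis.add_eq`, `IsPeriodBasis.mul_eq`), and the other square root belongs to
`(u ± 4v, 2v)`, because replacing `u` by `u ± 2v` changes the sign of `g`
(`IsPeriodBasis.shear`). As `2ⁿ τ → i∞` both theta constants tend to `1`, so following the theta
functions of a period basis `(u, v)` gives `π / (2 AGM) = u`, with finitely many flips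
(`IsPeriodBasis.exists_signs`). All period bases of a pair thus contribute values.

Conversely, let the signs be admissible. After `n` steps the pair has the period basis
`(u + 4cv, 2ⁿ v)` for some integer `c`. Near roots drive the ratio `g / a` to `1`
(`tendsto_div_of_near`). Once the ratio is close to `1`, a basis whose first member is shortest
within a class closed under the moves `v ↦ v ± u`, `u ↦ u ± 2v` (`IsReachable`) can be translated
to lie high in the upper half plane, since near the cusp `0` the ratio stays away from `± 1`; there
the near roots are the theta functions. Keeping track of the signs modulo `4` shows that
the value is `d u + c v` with `d ≡ 1` and `c ≡ 0` modulo `4` (`IsPeriodBasis.exists_hasAGM`).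

Gauss's integral is invariant under the arithmetic-geometric step, which identifies
`(K(k), i K(b))` as a period basis of `(1, b)` (`isPeriodBasis_ellipticK`); then
`(K(k) ± 2i K(b), i K(b))` are period bases of `(1, -b)`. For the latter, the theta functions
follow the near roots from the second step on (`shearRatio_re_pos`), which gives the two explicit
values. The lattices and the shortest elements are read off from the congruences for `d` and `c`
and a few explicit bases.
-/

/-! ### Squares of theta constants -/

namespace MultivaluedAGM

open Complex

/-- The square `θ₃(τ)²` of the theta constant `∑ exp(π i n² τ)`. Its companion `θ₄(τ)²` is
`thetaSq (τ + 1)`. -/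
noncomputable def thetaSq (τ : ℂ) : ℂ := jacobiTheta τ ^ 2

/-- The `n`-th term of the theta series. -/
noncomputable def thetaTerm (τ : ℂ) (n : ℤ) : ℂ := cexp (Real.pi * I * (n : ℂ) ^ 2 * τ)

lemma thetaTerm_add_one_of_even (τ : ℂ) {n : ℤ} (hn : Even n) :
    thetaTerm (τ + 1) n = thetaTerm τ n := by
  obtain ⟨k, rfl⟩ := hn
  rw [thetaTerm, thetaTerm, Complex.exp_eq_exp_iff_exists_int]
  exact ⟨2 * k ^ 2, by push_cast; ring⟩

lemma thetaTerm_add_one_of_odd (τ : ℂ) {n : ℤ} (hn : Odd n) :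
    thetaTerm (τ + 1) n = -thetaTerm τ n := by
  obtain ⟨k, rfl⟩ := hn
  have h : thetaTerm τ (2 * k + 1) * cexp (Real.pi * I) = -thetaTerm τ (2 * k + 1) := by
    rw [Complex.exp_pi_mul_I]; ring
  rw [← h, thetaTerm, thetaTerm, ← Complex.exp_add, Complex.exp_eq_exp_iff_exists_int]
  exact ⟨2 * k ^ 2 + 2 * k, by push_cast; ring⟩

lemma summable_norm_thetaTerm {τ : ℂ} (hτ : 0 < τ.im) : Summable fun n => ‖thetaTerm τ n‖ := by
  have h := ((summable_jacobiTheta₂_term_iff 0 τ).2 hτ).norm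
  simpa [jacobiTheta₂_term, thetaTerm] using h

lemma hasSum_thetaTerm_mul {τ τ' : ℂ} (hτ : 0 < τ.im) (hτ' : 0 < τ'.im) :
    HasSum (fun p : ℤ × ℤ => thetaTerm τ p.1 * thetaTerm τ' p.2)
      (jacobiTheta τ * jacobiTheta τ') := by
  have h := tsum_mul_tsum_of_summable_norm (summable_norm_thetaTerm hτ)
    (summable_norm_thetaTerm hτ')
  have hs := summable_mul_of_summable_norm (summable_norm_thetaTerm hτ)
    (summable_norm_thetaTerm hτ')
  have h' := hs.hasSum
  rw [← h] at h'
  exact h'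

/-- The sublattice of `ℤ²` of pairs with even sum is the image of `(x, y) ↦ (x + y, x - y)`; a sum
supported on it may be taken over `(x, y)`. -/
lemma hasSum_comp_rotate {G : ℤ × ℤ → ℂ} {s : ℂ} (hG : HasSum G s)
    (h0 : ∀ m n : ℤ, Odd (m + n) → G (m, n) = 0) :
    HasSum (fun p : ℤ × ℤ => G (p.1 + p.2, p.1 - p.2)) s := by
  have hinj : Function.Injective (fun p : ℤ × ℤ => (p.1 + p.2, p.1 - p.2)) := by
    rintro ⟨a, b⟩ ⟨c, d⟩ h
    simp only [Prod.mk.injEq] at h ⊢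
    omega
  refine (hinj.hasSum_iff ?_).2 hG
  rintro ⟨m, n⟩ hmn
  apply h0
  rw [← Int.not_even_iff_odd]
  rintro ⟨k, hk⟩
  exact hmn ⟨(k, m - k), by simp only [Prod.mk.injEq]; omega⟩

lemma thetaTerm_rotate (τ : ℂ) (x y : ℤ) :
    thetaTerm τ (x + y) * thetaTerm τ (x - y) = thetaTerm (2 * τ) x * thetaTerm (2 * τ) y := by
  simp only [thetaTerm, ← Complex.exp_add]
  congr 1
  push_cast
  ring

/-- The arithmetic mean of `θ₃(τ)²` and `θ₄(τ)²` is `θ₃(2τ)²`. -/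
lemma thetaSq_add (τ : ℂ) (hτ : 0 < τ.im) :
    thetaSq τ + thetaSq (τ + 1) = 2 * thetaSq (2 * τ) := by
  have hτ1 : 0 < (τ + 1).im := by simpa using hτ
  have hτ2 : 0 < (2 * τ).im := by simpa using hτ
  have h := hasSum_comp_rotate ((hasSum_thetaTerm_mul hτ hτ).add (hasSum_thetaTerm_mul hτ1 hτ1)) (by
    intro m n hmn
    simp only
    rcases Int.even_or_odd m with hm | hm
    · have hn : Odd n := by by_contra hn; rw [Int.not_odd_iff_even] at hn
                            exact (Int.not_even_iff_odd.2 hmn) (hm.add hn)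
      rw [thetaTerm_add_one_of_even _ hm, thetaTerm_add_one_of_odd _ hn]; ring
    · have hn : Even n := by by_contra hn; rw [Int.not_even_iff_odd] at hn
                             exact (Int.not_even_iff_odd.2 hmn) (hm.add_odd hn)
      rw [thetaTerm_add_one_of_even _ hn, thetaTerm_add_one_of_odd _ hm]; ring)
  have h2 := (hasSum_thetaTerm_mul hτ2 hτ2).mul_left 2
  rw [thetaSq, thetaSq, thetaSq, sq, sq, sq]
  refine h.unique (h2.congr_fun ?_)
  rintro ⟨x, y⟩
  simp only
  have hr := thetaTerm_rotate τ x y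
  rcases Int.even_or_odd (x + y) with hxy | hxy
  · have hxy' : Even (x - y) := by rw [Int.even_sub]; rwa [Int.even_add] at hxy
    rw [thetaTerm_add_one_of_even _ hxy, thetaTerm_add_one_of_even _ hxy', hr]; ring
  · have hxy' : Odd (x - y) := by rw [Int.odd_sub]; rwa [Int.odd_add] at hxy
    rw [thetaTerm_add_one_of_odd _ hxy, thetaTerm_add_one_of_odd _ hxy', neg_mul_neg, hr]; ring

/-- The double series of `θ₃(τ) θ₄(τ)` carries the sign `(-1)ⁿ` at `(m, n)`; it is averaged with
its transpose, so that the terms with `m + n` odd cancel. -/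
lemma jacobiTheta_mul_add_one (τ : ℂ) (hτ : 0 < τ.im) :
    jacobiTheta τ * jacobiTheta (τ + 1) = thetaSq (2 * τ + 1) := by
  have hτ1 : 0 < (τ + 1).im := by simpa using hτ
  have hτ2 : 0 < (2 * τ + 1).im := by simpa using hτ
  have h := hasSum_comp_rotate ((hasSum_thetaTerm_mul hτ hτ1).add (hasSum_thetaTerm_mul hτ1 hτ)) (by
    intro m n hmn
    simp only
    rcases Int.even_or_odd m with hm | hm
    · have hn : Odd n := by by_contra hn; rw [Int.not_odd_iff_even] at hn
                            exact (Int.not_even_iff_odd.2 hmn) (hm.add hn)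
      rw [thetaTerm_add_one_of_even _ hm, thetaTerm_add_one_of_odd _ hn]; ring
    · have hn : Even n := by by_contra hn; rw [Int.not_even_iff_odd] at hn
                             exact (Int.not_even_iff_odd.2 hmn) (hm.add_odd hn)
      rw [thetaTerm_add_one_of_even _ hn, thetaTerm_add_one_of_odd _ hm]; ring)
  have h2 := (hasSum_thetaTerm_mul hτ2 hτ2).mul_left 2
  have key := h.unique (h2.congr_fun ?_)
  · rw [thetaSq, sq]
    linear_combination key / 2
  rintro ⟨x, y⟩
  simp only
  have hr := thetaTerm_rotate τ x y
  rcases Int.even_or_odd (x + y) with hxy | hxy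
  · have hxy' : Even (x - y) := by rw [Int.even_sub]; rwa [Int.even_add] at hxy
    rw [thetaTerm_add_one_of_even _ hxy, thetaTerm_add_one_of_even _ hxy', hr]
    rcases Int.even_or_odd x with hx | hx
    · have hy : Even y := (Int.even_add.1 hxy).1 hx
      rw [thetaTerm_add_one_of_even _ hx, thetaTerm_add_one_of_even _ hy]; ring
    · have hy : Odd y := by
        rw [← Int.not_even_iff_odd] at hx ⊢
        rwa [← Int.even_add.1 hxy]
      rw [thetaTerm_add_one_of_odd _ hx, thetaTerm_add_one_of_odd _ hy]; ring
  · have hxy' : Odd (x - y) := by rw [Int.odd_sub]; rwa [Int.odd_add] at hxy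
    rw [thetaTerm_add_one_of_odd _ hxy, thetaTerm_add_one_of_odd _ hxy', mul_neg, neg_mul, hr]
    rcases Int.even_or_odd x with hx | hx
    · have hy : Odd y := by
        rw [← Int.not_even_iff_odd] at hxy ⊢
        intro hy
        exact hxy (hx.add hy)
      rw [thetaTerm_add_one_of_even _ hx, thetaTerm_add_one_of_odd _ hy]; ring
    · have hy : Even y := by
        by_contra hy
        rw [Int.not_even_iff_odd] at hy
        exact (Int.not_even_iff_odd.2 hxy) (hx.add_odd hy)
      rw [thetaTerm_add_one_of_odd _ hx, thetaTerm_add_one_of_even _ hy]; ring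

/-- The product of `θ₃(τ)²` and `θ₄(τ)²` is the square of `θ₄(2τ)²`. -/
lemma thetaSq_mul (τ : ℂ) (hτ : 0 < τ.im) :
    thetaSq τ * thetaSq (τ + 1) = thetaSq (2 * τ + 1) ^ 2 := by
  rw [← jacobiTheta_mul_add_one τ hτ, thetaSq, thetaSq]
  ring

lemma thetaSq_add_two (τ : ℂ) : thetaSq (τ + 2) = thetaSq τ := by
  rw [thetaSq, thetaSq, add_comm, jacobiTheta_two_add]

lemma im_neg_one_div {τ : ℂ} : (-1 / τ).im = τ.im / normSq τ := by
  rw [neg_div, one_div, neg_im, inv_im]; ring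

lemma im_neg_one_div_pos {τ : ℂ} (hτ : 0 < τ.im) : 0 < (-1 / τ).im := by
  rw [im_neg_one_div]
  refine div_pos hτ (normSq_pos.2 ?_)
  rintro rfl
  simp at hτ

/-- The transformation of `θ₃²` under `τ ↦ -1/τ`. -/
lemma thetaSq_neg_one_div (τ : ℂ) (hτ : 0 < τ.im) :
    thetaSq (-1 / τ) = -I * τ * thetaSq τ := by
  have h := jacobiTheta_S_smul ⟨τ, hτ⟩
  have h2 : ((ModularGroup.S • (⟨τ, hτ⟩ : UpperHalfPlane) : UpperHalfPlane) : ℂ) = -1 / τ := by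
    rw [UpperHalfPlane.modular_S_smul]
    simp [neg_div]
  rw [h2] at h
  rw [thetaSq, h, thetaSq, mul_pow, ← Complex.cpow_nat_mul]
  norm_num

lemma norm_jacobiTheta_sub_one_le_of_le {τ : ℂ} {q : ℝ} (hτ : 0 < τ.im)
    (hq : Real.exp (-Real.pi * τ.im) ≤ q) (hq1 : q < 1) :
    ‖jacobiTheta τ - 1‖ ≤ 2 * q / (1 - q) := by
  refine (norm_jacobiTheta_sub_one_le hτ).trans ?_
  rw [div_mul_eq_mul_div]
  have := Real.exp_pos (-Real.pi * τ.im)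
  gcongr
  linarith

lemma norm_jacobiTheta_sub_one_le_of_half_le {τ : ℂ} (hτ : 1 / 2 ≤ τ.im) :
    ‖jacobiTheta τ - 1‖ ≤ 3 / 5 := by
  -- `exp (-π / 2) ≤ exp (-3 / 2) ≤ 3 / 13`, and `2q / (1 - q) = 3 / 5` at `q = 3 / 13`
  have h := norm_jacobiTheta_sub_one_le_of_le (τ := τ) (q := 3 / 13) (by linarith) ?_ (by norm_num)
  · norm_num at h; linarith
  have h1 : Real.exp (-Real.pi * τ.im) ≤ Real.exp (-(3 / 2)) := by
    apply Real.exp_le_exp.2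
    nlinarith [Real.pi_gt_three]
  refine h1.trans ?_
  have h2 : (13 / 3 : ℝ) ≤ Real.exp (3 / 2) := by
    have := Real.sum_le_exp_of_nonneg (x := 3 / 2) (by norm_num) 6
    simp [Finset.sum_range_succ, Nat.factorial] at this
    norm_num at this
    linarith
  rw [Real.exp_neg, inv_le_comm₀ (Real.exp_pos _) (by norm_num)]
  linarith

lemma norm_jacobiTheta_sub_one_le_of_one_le {τ : ℂ} (hτ : 1 ≤ τ.im) :
    ‖jacobiTheta τ - 1‖ ≤ 1 / 9 := by
  -- `exp (-π) ≤ exp (-3) ≤ 1 / 19`, and `2q / (1 - q) = 1 / 9` at `q = 1 / 19`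
  have h := norm_jacobiTheta_sub_one_le_of_le (τ := τ) (q := 1 / 19) (by linarith) ?_ (by norm_num)
  · norm_num at h; linarith
  have h1 : Real.exp (-Real.pi * τ.im) ≤ Real.exp (-3) := by
    apply Real.exp_le_exp.2
    nlinarith [Real.pi_gt_three]
  refine h1.trans ?_
  have h2 : (19 : ℝ) ≤ Real.exp 3 := by
    have := Real.sum_le_exp_of_nonneg (x := 3) (by norm_num) 9
    simp [Finset.sum_range_succ, Nat.factorial] at this
    norm_num at this
    linarith
  rw [Real.exp_neg, inv_le_comm₀ (Real.exp_pos _) (by norm_num)]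
  linarith

lemma tendsto_jacobiTheta {x : ℕ → ℂ} (hx : Tendsto (fun n => (x n).im) atTop atTop) :
    Tendsto (fun n => jacobiTheta (x n)) atTop (𝓝 1) := by
  have h1 : Tendsto (fun n => Real.exp (-Real.pi * (x n).im)) atTop (𝓝 0) :=
    Real.tendsto_exp_atBot.comp (hx.const_mul_atTop_of_neg (by linarith [Real.pi_pos]))
  have h2 : Tendsto x atTop (comap im atTop) := tendsto_comap_iff.2 hx
  have h3 := (isBigO_at_im_infty_jacobiTheta_sub_one.comp_tendsto h2).trans_tendsto h1
  simpa using h3.add_const 1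

lemma tendsto_thetaSq {x : ℕ → ℂ} (hx : Tendsto (fun n => (x n).im) atTop atTop) :
    Tendsto (fun n => thetaSq (x n)) atTop (𝓝 1) := by
  simpa [thetaSq] using (tendsto_jacobiTheta hx).pow 2

lemma im_two_pow_mul (n : ℕ) (z : ℂ) : (2 ^ n * z).im = 2 ^ n * z.im := by
  have : ((2 : ℂ) ^ n) = ((2 ^ n : ℝ) : ℂ) := by push_cast; rfl
  rw [this, Complex.im_ofReal_mul]

lemma tendsto_two_pow_mul_im {z : ℂ} (hz : 0 < z.im) :
    Tendsto (fun n : ℕ => (2 ^ n * z).im) atTop atTop := by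
  simp only [im_two_pow_mul]
  exact (tendsto_pow_atTop_atTop_of_one_lt one_lt_two).atTop_mul_const hz

/-- The theta constant has no zeros: since `θ₃(τ) θ₄(τ) = θ₃(2τ + 1)²`, a zero at `τ` is followed
by zeros at `2τ + 1`, `4τ + 3`, …, whereas `θ₃` tends to `1` there. -/
lemma jacobiTheta_ne_zero {τ : ℂ} (hτ : 0 < τ.im) : jacobiTheta τ ≠ 0 := by
  intro h0
  have key : ∀ n : ℕ, jacobiTheta (2 ^ n * (τ + 1) - 1) = 0 := by
    intro n
    induction n with
    | zero => simpa using h0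
    | succ n ih =>
      have him : 0 < (2 ^ n * (τ + 1) - 1 : ℂ).im := by
        rw [sub_im, im_two_pow_mul]
        simpa using hτ
      have h := jacobiTheta_mul_add_one _ him
      rw [ih, zero_mul, eq_comm, thetaSq] at h
      have h' := pow_eq_zero_iff (two_ne_zero) |>.1 h
      rw [← h']
      congr 1
      ring
  have hlim := tendsto_jacobiTheta (x := fun n => 2 ^ n * (τ + 1) - 1) ?_
  · simp only [key] at hlim
    exact zero_ne_one (tendsto_nhds_unique tendsto_const_nhds hlim)
  · have h := tendsto_two_pow_mul_im (z := τ + 1) (by simpa using hτ)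
    refine h.congr fun n => ?_
    simp

lemma thetaSq_ne_zero {τ : ℂ} (hτ : 0 < τ.im) : thetaSq τ ≠ 0 :=
  pow_ne_zero 2 (jacobiTheta_ne_zero hτ)

/-- Jacobi's identity `θ₃⁴ - θ₄⁴ = θ₂⁴`, with `θ₂(τ)²` written as a multiple of `θ₄(-1/τ)²`. -/
lemma thetaSq_neg_one_div_add_one_sq (τ : ℂ) (hτ : 0 < τ.im) :
    thetaSq (-1 / τ + 1) ^ 2 = -τ ^ 2 * (thetaSq τ ^ 2 - thetaSq (τ + 1) ^ 2) := by
  have h0 : τ ≠ 0 := by rintro rfl; simp at hτ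
  have hτ2 : 0 < (2 * τ).im := by simpa using hτ
  have hs : 0 < (-1 / (2 * τ)).im := im_neg_one_div_pos hτ2
  have e : 2 * (-1 / (2 * τ)) = -1 / τ := by field_simp
  have h1 := thetaSq_mul _ hs
  have h2 := thetaSq_add _ hs
  rw [e] at h1 h2
  rw [thetaSq_neg_one_div _ hτ] at h2
  rw [thetaSq_neg_one_div _ hτ2] at h1 h2
  have h3 := thetaSq_add τ hτ
  have h4 : thetaSq (-1 / (2 * τ) + 1) = 2 * (-I * τ * thetaSq τ)
      - -I * (2 * τ) * thetaSq (2 * τ) := by linear_combination h2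
  rw [← h1, h4]
  have h5 : thetaSq (τ + 1) = 2 * thetaSq (2 * τ) - thetaSq τ := by linear_combination h3
  rw [h5]
  linear_combination (4 * τ ^ 2 * thetaSq (2 * τ) * thetaSq τ
    - 4 * τ ^ 2 * thetaSq (2 * τ) ^ 2) * I_sq

lemma continuousAt_thetaSq {τ : ℂ} (hτ : 0 < τ.im) : ContinuousAt thetaSq τ :=
  (continuousAt_jacobiTheta hτ).pow 2

end MultivaluedAGM

/-! ### Period bases of a pair -/

namespace MultivaluedAGM

open Complex

/-- The square of the theta constant as a homogeneous function of degree `-1` of a basis `(u, v)`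
of a lattice, scaled by `π / 2`. -/
noncomputable def latticeTheta (u v : ℂ) : ℂ := Real.pi / 2 * thetaSq (v / u) / u

/-- `(u, v)` is a period basis of the pair `(a, g)`: with `τ = v / u` in the upper half plane,
`a = (π / 2u) θ₃(τ)²` and `g = (π / 2u) θ₄(τ)²`. For `(a, g) = (1, b)` this is solved by
`u = K(k)`, `v = i K(b)`. -/
structure IsPeriodBasis (a g u v : ℂ) : Prop where
  im_pos : 0 < (v / u).im
  fst_eq : a = latticeTheta u v
  snd_eq : g = latticeTheta u (v + u)

lemma ne_zero_of_im_div_pos {u v : ℂ} (h : 0 < (v / u).im) : u ≠ 0 ∧ v ≠ 0 := by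
  constructor <;> · rintro rfl; simp at h

lemma latticeTheta_ne_zero {u v : ℂ} (h : 0 < (v / u).im) : latticeTheta u v ≠ 0 := by
  have hu := (ne_zero_of_im_div_pos h).1
  have := thetaSq_ne_zero h
  have hpi : (Real.pi : ℂ) ≠ 0 := by exact_mod_cast Real.pi_ne_zero
  exact div_ne_zero (mul_ne_zero (div_ne_zero hpi two_ne_zero) this) hu

lemma latticeTheta_add_two_mul {u : ℂ} (v : ℂ) (hu : u ≠ 0) :
    latticeTheta u (v + 2 * u) = latticeTheta u v := by
  rw [latticeTheta, latticeTheta, show (v + 2 * u) / u = v / u + 2 by field_simp, thetaSq_add_two]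

lemma latticeTheta_neg_neg (u v : ℂ) : latticeTheta (-u) (-v) = -latticeTheta u v := by
  rw [latticeTheta, latticeTheta, neg_div_neg_eq, div_neg]

lemma latticeTheta_rotate {u v : ℂ} (h : 0 < (v / u).im) :
    latticeTheta v (-u) = -I * latticeTheta u v := by
  obtain ⟨hu, hv⟩ := ne_zero_of_im_div_pos h
  rw [latticeTheta, latticeTheta, show -u / v = -1 / (v / u) by field_simp,
    thetaSq_neg_one_div _ h]
  field_simp

lemma im_div_add_self {u : ℂ} (v : ℂ) (hu : u ≠ 0) : ((v + u) / u).im = (v / u).im := by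
  rw [add_div, div_self hu]; simp

lemma im_div_shear_pos {u v : ℂ} (h : 0 < (v / u).im) (c : ℝ) : 0 < (v / (u + c * v)).im := by
  obtain ⟨hu, hv⟩ := ne_zero_of_im_div_pos h
  have h1 : 0 < (-1 / (v / u) - c).im := by simpa using im_neg_one_div_pos h
  have h2 := im_neg_one_div_pos h1
  have e : -1 / (v / u) - c = -((u + c * v) / v) := by field_simp; ring
  rwa [e, neg_div_neg_eq, one_div_div] at h2

/-- Adding `2v` to `u` fixes `θ₃²`; the proof conjugates the shift `τ ↦ τ + 2` by `τ ↦ -1/τ`. -/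
lemma latticeTheta_shear {u v : ℂ} (h : 0 < (v / u).im) :
    latticeTheta (u + 2 * v) v = latticeTheta u v := by
  obtain ⟨hu, hv⟩ := ne_zero_of_im_div_pos h
  have h1 := latticeTheta_rotate h
  have h2 := latticeTheta_rotate (u := u + 2 * v) (by exact_mod_cast im_div_shear_pos h 2)
  have h3 := latticeTheta_add_two_mul (-(u + 2 * v)) hv
  rw [show -(u + 2 * v) + 2 * v = -u by ring, h1, h2] at h3
  have : (-I : ℂ) ≠ 0 := by simp
  exact (mul_left_cancel₀ this h3).symm

namespace IsPeriodBasis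

variable {a g u v : ℂ}

lemma left_ne_zero (h : IsPeriodBasis a g u v) : u ≠ 0 := (ne_zero_of_im_div_pos h.im_pos).1

lemma right_ne_zero (h : IsPeriodBasis a g u v) : v ≠ 0 := (ne_zero_of_im_div_pos h.im_pos).2

lemma fst_ne_zero (h : IsPeriodBasis a g u v) : a ≠ 0 := by
  rw [h.fst_eq]; exact latticeTheta_ne_zero h.im_pos

lemma swap (h : IsPeriodBasis a g u v) : IsPeriodBasis g a u (v + u) where
  im_pos := by rw [im_div_add_self _ h.left_ne_zero]; exact h.im_pos
  fst_eq := h.snd_eq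
  snd_eq := by
    rw [h.fst_eq, add_assoc, ← two_mul, latticeTheta_add_two_mul _ h.left_ne_zero]

lemma swap' (h : IsPeriodBasis a g u v) : IsPeriodBasis g a u (v - u) where
  im_pos := by
    have := h.im_pos
    rwa [← im_div_add_self _ h.left_ne_zero, sub_add_cancel]
  fst_eq := by
    rw [h.snd_eq, ← latticeTheta_add_two_mul (v - u) h.left_ne_zero]
    congr 1; ring
  snd_eq := by rw [h.fst_eq, sub_add_cancel]

lemma snd_ne_zero (h : IsPeriodBasis a g u v) : g ≠ 0 := h.swap.fst_ne_zero

lemma neg (h : IsPeriodBasis a g u v) : IsPeriodBasis (-a) (-g) (-u) (-v) where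
  im_pos := by rw [neg_div_neg_eq]; exact h.im_pos
  fst_eq := by rw [latticeTheta_neg_neg, h.fst_eq]
  snd_eq := by rw [← neg_add, latticeTheta_neg_neg, h.snd_eq]

/-- Adding `2v` to `u` changes the sign of the second member of the pair: `g` is the first member
of the pair of `(u, v + u)`, and subtracting `2(v + u)` from `u` gives `-(u + 2v)`, where the sign
comes from homogeneity of odd degree. -/
lemma shear (h : IsPeriodBasis a g u v) : IsPeriodBasis a (-g) (u + 2 * v) v where
  im_pos := by exact_mod_cast im_div_shear_pos h.im_pos 2
  fst_eq := by rw [latticeTheta_shear h.im_pos, h.fst_eq]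
  snd_eq := by
    have h1 := h.swap.im_pos
    have h2 : 0 < ((v + u) / (u - 2 * (v + u))).im := by
      simpa [sub_eq_add_neg] using im_div_shear_pos h1 (-2)
    have h3 := latticeTheta_shear h2
    rw [sub_add_cancel, ← h.snd_eq] at h3
    have h4 := latticeTheta_neg_neg (u - 2 * (v + u)) (v + u)
    rw [← h3] at h4
    rw [← h4, show -(u - 2 * (v + u)) = u + 2 * v by ring,
      ← latticeTheta_add_two_mul (-(v + u))]
    · congr 1; ring
    · have := (ne_zero_of_im_div_pos h2).1
      rwa [show u + 2 * v = -(u - 2 * (v + u)) by ring, neg_ne_zero]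

lemma shear' (h : IsPeriodBasis a g u v) : IsPeriodBasis a (-g) (u - 2 * v) v := by
  have h1 : 0 < (v / (u - 2 * v)).im := by
    simpa [sub_eq_add_neg] using im_div_shear_pos h.im_pos (-2)
  have h2 : IsPeriodBasis _ _ _ _ := shear ⟨h1, rfl, rfl⟩
  rw [sub_add_cancel] at h2
  refine ⟨h1, ?_, ?_⟩
  · rw [h.fst_eq, h2.fst_eq]
  · rw [h.snd_eq, ← h2.snd_eq, neg_neg]

lemma shear_four (h : IsPeriodBasis a g u v) : IsPeriodBasis a g (u + 4 * v) v := by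
  have h1 := h.shear.shear
  rwa [neg_neg, add_assoc, ← add_mul, show (2 : ℂ) + 2 = 4 by norm_num] at h1

/-- The arithmetic mean of a pair is the first member of the pair of `(u, 2v)`. -/
lemma add_eq (h : IsPeriodBasis a g u v) : a + g = 2 * latticeTheta u (2 * v) := by
  have hu := h.left_ne_zero
  have h1 := thetaSq_add _ h.im_pos
  rw [h.fst_eq, h.snd_eq, latticeTheta, latticeTheta, latticeTheta,
    show (v + u) / u = v / u + 1 by field_simp, mul_div_assoc 2 v u]
  linear_combination (Real.pi / 2 / u : ℂ) * h1

/-- One square root of `a g` is the second member of the pair of `(u, 2v)`. -/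
lemma mul_eq (h : IsPeriodBasis a g u v) : a * g = latticeTheta u (2 * v + u) ^ 2 := by
  have hu := h.left_ne_zero
  have h1 := thetaSq_mul _ h.im_pos
  rw [h.fst_eq, h.snd_eq, latticeTheta, latticeTheta, latticeTheta,
    show (v + u) / u = v / u + 1 by field_simp,
    show (2 * v + u) / u = 2 * (v / u) + 1 by field_simp]
  linear_combination (Real.pi / 2 / u : ℂ) ^ 2 * h1

lemma im_two_mul_pos (h : IsPeriodBasis a g u v) : 0 < (2 * v / u).im := by
  rw [mul_div_assoc]; simpa using h.im_pos

lemma double (h : IsPeriodBasis a g u v) {r : ℂ} (hr : r = latticeTheta u (2 * v + u)) :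
    IsPeriodBasis ((a + g) / 2) r u (2 * v) :=
  ⟨h.im_two_mul_pos, by rw [h.add_eq]; ring, hr⟩

/-- Each of the two choices of the geometric mean has a period basis. -/
lemma double_of_sq_eq (h : IsPeriodBasis a g u v) {r : ℂ} (hr : r ^ 2 = a * g) :
    IsPeriodBasis ((a + g) / 2) r u (2 * v) ∨
      IsPeriodBasis ((a + g) / 2) r (u + 4 * v) (2 * v) := by
  rw [h.mul_eq, sq_eq_sq_iff_eq_or_eq_neg] at hr
  rcases hr with hr | hr
  · exact Or.inl (h.double hr)
  · right
    have h1 := (h.double rfl).shear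
    rw [← hr] at h1
    convert h1 using 1
    ring

lemma add_ne_zero (h : IsPeriodBasis a g u v) : a + g ≠ 0 := by
  rw [h.add_eq]
  exact mul_ne_zero two_ne_zero (latticeTheta_ne_zero h.im_two_mul_pos)

lemma div_eq (h : IsPeriodBasis a g u v) : g / a = thetaSq (v / u + 1) / thetaSq (v / u) := by
  have hu := h.left_ne_zero
  have hpi : (Real.pi : ℂ) ≠ 0 := by exact_mod_cast Real.pi_ne_zero
  have := thetaSq_ne_zero h.im_pos
  rw [h.fst_eq, h.snd_eq, latticeTheta, latticeTheta,
    show (v + u) / u = v / u + 1 by field_simp]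
  field_simp

lemma two_pow (h : IsPeriodBasis a g u v) (n : ℕ) :
    IsPeriodBasis (latticeTheta u (2 ^ n * v)) (latticeTheta u (2 ^ n * v + u)) u (2 ^ n * v) :=
  ⟨by rw [mul_div_assoc, im_two_pow_mul]; have := h.im_pos; positivity, rfl, rfl⟩

lemma tendsto_fst (h : IsPeriodBasis a g u v) :
    Tendsto (fun n : ℕ => latticeTheta u (2 ^ n * v)) atTop (𝓝 (Real.pi / (2 * u))) := by
  have hu := h.left_ne_zero
  have h1 := ((tendsto_thetaSq (tendsto_two_pow_mul_im h.im_pos)).const_mul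
    (Real.pi / 2 : ℂ)).div_const u
  rw [mul_one, div_div] at h1
  simpa only [latticeTheta, mul_div_assoc] using h1

lemma tendsto_snd (h : IsPeriodBasis a g u v) :
    Tendsto (fun n : ℕ => latticeTheta u (2 ^ n * v + u)) atTop (𝓝 (Real.pi / (2 * u))) := by
  have hu := h.left_ne_zero
  have h1 := ((tendsto_thetaSq (x := fun n => 2 ^ n * (v / u) + 1) ?_).const_mul
    (Real.pi / 2 : ℂ)).div_const u
  · rw [mul_one, div_div] at h1
    refine h1.congr fun n => ?_
    rw [latticeTheta, add_div, div_self hu, ← mul_div_assoc]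
  · simpa using tendsto_two_pow_mul_im h.im_pos

end IsPeriodBasis
end MultivaluedAGM

/-! ### The arithmetic-geometric iteration -/

namespace MultivaluedAGM

open Complex

lemma nearRoot_sq (a g : ℂ) : nearRoot a g ^ 2 = a * g := by
  have h : ((a * g) ^ (1 / 2 : ℂ)) ^ 2 = a * g := by
    rw [← Complex.cpow_nat_mul]; norm_num
  unfold nearRoot
  simp only
  split_ifs <;> simp only [neg_sq, h]

lemma nearRoot_im_nonneg_of_tie {a g : ℂ} (h : (nearRoot a g / (a + g)).re = 0) :
    0 ≤ (nearRoot a g).im := by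
  unfold nearRoot at h ⊢
  simp only at h ⊢
  split_ifs at h ⊢ with h1 h2 h3
  · exact absurd h h1.ne'
  · rw [neg_div, neg_re, neg_eq_zero] at h
    exact absurd h h2.ne
  · exact h3
  · rw [neg_im]; linarith

lemma nearRoot_re_nonneg (a g : ℂ) : 0 ≤ (nearRoot a g / (a + g)).re := by
  unfold nearRoot
  simp only
  split_ifs with h1 h2 h3
  · exact h1.le
  · rw [neg_div, neg_re]; linarith
  · exact not_lt.1 h2
  · rw [neg_div, neg_re]; linarith

lemma eq_nearRoot_or_eq_neg {a g z : ℂ} (hz : z ^ 2 = a * g) :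
    z = nearRoot a g ∨ z = -nearRoot a g := by
  rw [← nearRoot_sq] at hz
  exact sq_eq_sq_iff_eq_or_eq_neg.1 hz

lemma nearRoot_eq_of_re_pos {a g z : ℂ} (hz : z ^ 2 = a * g) (h : 0 < (z / (a + g)).re) :
    nearRoot a g = z := by
  rcases eq_nearRoot_or_eq_neg hz with h1 | h1
  · exact h1.symm
  · have := nearRoot_re_nonneg a g
    rw [h1, neg_div, neg_re] at h
    linarith

lemma units_eq_or_eq_neg (s : ℤˣ) (z : ℂ) : ((s : ℤ) : ℂ) * z = z ∨ ((s : ℤ) : ℂ) * z = -z := by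
  rcases Int.units_eq_one_or s with rfl | rfl <;> simp

lemma agmSeq_add (σ : ℕ → ℤˣ) (a g : ℂ) (N n : ℕ) :
    agmSeq σ a g (N + n) =
      agmSeq (fun k => σ (N + k)) (agmSeq σ a g N).1 (agmSeq σ a g N).2 n := by
  induction n with
  | zero => rfl
  | succ n ih => rw [← add_assoc, agmSeq, ih, agmSeq]

lemma hasAGM_of_tail {σ : ℕ → ℤˣ} {a g M : ℂ} (N : ℕ)
    (h : HasAGM (fun k => σ (N + k)) (agmSeq σ a g N).1 (agmSeq σ a g N).2 M) :
    HasAGM σ a g M := by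
  simp only [HasAGM, ← agmSeq_add] at h
  simp only [add_comm N] at h
  exact ⟨(tendsto_add_atTop_iff_nat N).1 h.1, (tendsto_add_atTop_iff_nat N).1 h.2⟩

lemma HasAGM.unique {σ : ℕ → ℤˣ} {a g M M' : ℂ} (h : HasAGM σ a g M) (h' : HasAGM σ a g M') :
    M = M' := tendsto_nhds_unique h.1 h'.1

namespace IsPeriodBasis

variable {a g u v : ℂ}

lemma agmSeq_eq (h : IsPeriodBasis a g u v) {σ : ℕ → ℤˣ}
    (hσ : ∀ n : ℕ, latticeTheta u (2 ^ (n + 1) * v + u) = ((σ n : ℤ) : ℂ) *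
      nearRoot (latticeTheta u (2 ^ n * v)) (latticeTheta u (2 ^ n * v + u))) (n : ℕ) :
    agmSeq σ a g n = (latticeTheta u (2 ^ n * v), latticeTheta u (2 ^ n * v + u)) := by
  induction n with
  | zero => simp [agmSeq, ← h.fst_eq, ← h.snd_eq]
  | succ n ih =>
    rw [agmSeq, ih]
    simp only
    rw [← hσ, (h.two_pow n).add_eq, mul_div_cancel_left₀ _ two_ne_zero, ← mul_assoc, pow_succ']

/-- If the signs follow the theta functions, the mean is read off from the limit `τ → i∞`. -/
lemma hasAGM_of_signs (h : IsPeriodBasis a g u v) {σ : ℕ → ℤˣ}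
    (hσ : ∀ n : ℕ, latticeTheta u (2 ^ (n + 1) * v + u) = ((σ n : ℤ) : ℂ) *
      nearRoot (latticeTheta u (2 ^ n * v)) (latticeTheta u (2 ^ n * v + u))) :
    HasAGM σ a g (Real.pi / (2 * u)) :=
  ⟨by simpa only [h.agmSeq_eq hσ] using h.tendsto_fst,
    by simpa only [h.agmSeq_eq hσ] using h.tendsto_snd⟩

lemma snd_sq_eq (h : IsPeriodBasis a g u v) (n : ℕ) :
    latticeTheta u (2 ^ (n + 1) * v + u) ^ 2 =
      latticeTheta u (2 ^ n * v) * latticeTheta u (2 ^ n * v + u) := by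
  rw [(h.two_pow n).mul_eq, ← mul_assoc, ← pow_succ']

lemma sum_eq (h : IsPeriodBasis a g u v) (n : ℕ) :
    latticeTheta u (2 ^ n * v) + latticeTheta u (2 ^ n * v + u) =
      2 * latticeTheta u (2 ^ (n + 1) * v) := by
  rw [(h.two_pow n).add_eq, ← mul_assoc, pow_succ']

lemma nearRoot_eq (h : IsPeriodBasis a g u v) (n : ℕ)
    (hre : 0 < (latticeTheta u (2 ^ (n + 1) * v + u) / latticeTheta u (2 ^ (n + 1) * v)).re) :
    nearRoot (latticeTheta u (2 ^ n * v)) (latticeTheta u (2 ^ n * v + u)) =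
      latticeTheta u (2 ^ (n + 1) * v + u) := by
  apply nearRoot_eq_of_re_pos (h.snd_sq_eq n)
  rw [h.sum_eq, mul_comm (2 : ℂ), ← div_div, show (2 : ℂ) = ((2 : ℝ) : ℂ) by norm_num, 
    div_ofReal_re]
  positivity

/-- Following the theta functions of a period basis amounts to finitely many flips, as the ratio of
the pair tends to `1`. -/
lemma exists_signs (h : IsPeriodBasis a g u v) :
    ∃ σ : ℕ → ℤˣ, FinitelyManyFlips σ ∧ HasAGM σ a g (Real.pi / (2 * u)) := by
  classical
  let σ : ℕ → ℤˣ := fun n => if nearRoot (latticeTheta u (2 ^ n * v))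
    (latticeTheta u (2 ^ n * v + u)) = latticeTheta u (2 ^ (n + 1) * v + u) then 1 else -1
  refine ⟨σ, ?_, h.hasAGM_of_signs fun n => ?_⟩
  · have hu := h.left_ne_zero
    have hpi : (Real.pi : ℂ) ≠ 0 := by exact_mod_cast Real.pi_ne_zero
    have hne : (Real.pi / (2 * u) : ℂ) ≠ 0 := div_ne_zero hpi (mul_ne_zero two_ne_zero hu)
    have h1 := h.tendsto_snd.div h.tendsto_fst hne
    rw [div_self hne] at h1
    have h2 := ((continuous_re.tendsto _).comp h1).comp (tendsto_add_atTop_nat 1)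
    filter_upwards [h2.eventually (lt_mem_nhds (by simp : (0 : ℝ) < (1 : ℂ).re))] with n hn
    exact if_pos (h.nearRoot_eq n hn)
  · simp only [σ]
    split_ifs with h1
    · simp [h1]
    · rcases eq_nearRoot_or_eq_neg (h.snd_sq_eq n) with h2 | h2
      · exact absurd h2.symm h1
      · simp [h2]

lemma mem_invAGMValues {x : ℂ} (h : IsPeriodBasis 1 x u v) : u ∈ invAGMValues x := by
  obtain ⟨σ, hσ, hM⟩ := h.exists_signs
  have hu := h.left_ne_zero
  have hpi : (Real.pi : ℂ) ≠ 0 := by exact_mod_cast Real.pi_ne_zero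
  exact ⟨σ, hσ, _, div_ne_zero hpi (mul_ne_zero two_ne_zero hu), hM, by field_simp⟩

/-- High in the upper half plane the near roots are the theta functions. -/
lemma div_re_pos_of_one_le (h : IsPeriodBasis a g u v) (him : 1 ≤ (v / u).im) :
    0 < (g / a).re := by
  rw [h.div_eq, thetaSq, thetaSq, ← div_pow]
  have h1 := norm_jacobiTheta_sub_one_le_of_one_le him
  have h2 := norm_jacobiTheta_sub_one_le_of_one_le (τ := v / u + 1) (by simpa using him)
  have h0 := jacobiTheta_ne_zero h.im_pos
  set x := jacobiTheta (v / u)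
  set y := jacobiTheta (v / u + 1)
  have h3 : 8 / 9 ≤ ‖x‖ := by
    have := norm_sub_norm_le (1 : ℂ) (1 - x)
    rw [norm_sub_rev] at h1
    simp at this; linarith
  have h4 : ‖y / x - 1‖ ≤ 1 / 4 := by
    rw [div_sub_one h0, norm_div, div_le_iff₀ (by linarith)]
    have := norm_sub_le (y - 1) (x - 1)
    rw [sub_sub_sub_cancel_right] at this
    linarith
  set e := y / x - 1 with he
  rw [show y / x = 1 + e by rw [he]; ring]
  have h5 := (abs_le.1 (abs_re_le_norm e)).1
  have h6 := (abs_le.1 (abs_re_le_norm (e ^ 2))).1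
  rw [norm_pow] at h6
  have h7 : ‖e‖ ^ 2 ≤ 1 / 16 := by nlinarith [norm_nonneg e]
  have h8 : ((1 + e) ^ 2).re = 1 + 2 * e.re + (e ^ 2).re := by
    rw [show (1 + e) ^ 2 = 1 + 2 * e + e ^ 2 by ring]; simp
  rw [h8]; linarith

lemma hasAGM_one_of_half_le (h : IsPeriodBasis a g u v) (him : 1 / 2 ≤ (v / u).im) :
    HasAGM 1 a g (Real.pi / (2 * u)) := by
  refine h.hasAGM_of_signs fun n => ?_
  rw [h.nearRoot_eq n]
  · simp
  · apply (h.two_pow (n + 1)).div_re_pos_of_one_le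
    rw [mul_div_assoc, im_two_pow_mul, pow_succ]
    have : (1 : ℝ) ≤ 2 ^ n := one_le_pow₀ one_le_two
    nlinarith

/-- Whatever the signs, the `n`-th pair has a period basis of the form `(u + 4cv, 2ⁿ v)`. -/
lemma exists_agmSeq (h : IsPeriodBasis a g u v) (σ : ℕ → ℤˣ) (n : ℕ) :
    ∃ c : ℤ, IsPeriodBasis (agmSeq σ a g n).1 (agmSeq σ a g n).2
      (u + (4 * c : ℤ) * v) (2 ^ n * v) := by
  induction n with
  | zero => exact ⟨0, by simpa [agmSeq] using h⟩
  | succ n ih =>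
    obtain ⟨c, hc⟩ := ih
    have hr : (((σ n : ℤ) : ℂ) * nearRoot (agmSeq σ a g n).1 (agmSeq σ a g n).2) ^ 2 =
        (agmSeq σ a g n).1 * (agmSeq σ a g n).2 := by
      rcases units_eq_or_eq_neg (σ n) (nearRoot (agmSeq σ a g n).1 (agmSeq σ a g n).2)
        with h1 | h1 <;> simp [h1, nearRoot_sq]
    rcases hc.double_of_sq_eq hr with h1 | h1
    · refine ⟨c, ?_⟩
      rw [pow_succ', mul_assoc]
      exact h1
    · refine ⟨c + 2 ^ n, ?_⟩
      rw [pow_succ', mul_assoc]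
      have e : u + (4 * (c + 2 ^ n) : ℤ) * v = u + (4 * c : ℤ) * v + 4 * (2 ^ n * v) := by
        push_cast; ring
      rw [e]
      exact h1

end IsPeriodBasis

/-! ### Near roots force the ratio to tend to one -/

/-- One step with the near root: `Z = (a - g) / (a + g)` satisfies `|Z'| ≤ |Z|²`. -/
lemma norm_step_le {a g r : ℂ} (hs : a + g ≠ 0) (hr : r ^ 2 = a * g)
    (hre : 0 ≤ (r / (a + g)).re) :
    ‖((a + g) / 2 - r) / ((a + g) / 2 + r)‖ ≤ ‖(a - g) / (a + g)‖ ^ 2 := by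
  set ρ := 2 * (r / (a + g)) with hρ
  have hre' : 0 ≤ ρ.re := by rw [hρ]; simpa using hre
  have hn : 1 ≤ ‖1 + ρ‖ := by
    refine le_trans ?_ (re_le_norm _)
    simpa using hre'
  have hne : 1 + ρ ≠ 0 := norm_pos_iff.1 (by linarith)
  have e1 : ((a + g) / 2 - r) / ((a + g) / 2 + r) = (1 - ρ) / (1 + ρ) := by
    have e : r = (a + g) / 2 * ρ := by rw [hρ]; field_simp
    rw [e, ← mul_one_sub, ← mul_one_add, mul_div_mul_left]
    simpa using hs
  have e2 : ((a - g) / (a + g)) ^ 2 = (1 - ρ) * (1 + ρ) := by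
    rw [hρ]; field_simp; linear_combination 4 * hr
  rw [← norm_pow, e2, norm_mul, e1, norm_div, div_le_iff₀ (by linarith), mul_assoc]
  have := norm_nonneg (1 - ρ)
  nlinarith [mul_self_nonneg (‖1 + ρ‖ - 1), mul_le_mul hn hn zero_le_one (norm_nonneg _)]

/-- The Cayley transform maps the right half plane into the unit disk. -/
lemma norm_div_lt_one {a g : ℂ} (ha : a ≠ 0) (hs : a + g ≠ 0) (h : 0 < (g / a).re) :
    ‖(a - g) / (a + g)‖ < 1 := by
  have e : (a - g) / (a + g) = (1 - g / a) / (1 + g / a) := by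
    have : 1 + g / a = (a + g) / a := by field_simp
    rw [this]; field_simp
  have hne : 1 + g / a ≠ 0 := by
    intro h0
    have := congrArg re h0
    simp only [add_re, one_re, zero_re] at this
    linarith
  rw [e, norm_div, div_lt_one (norm_pos_iff.2 hne)]
  apply lt_of_pow_lt_pow_left₀ 2 (norm_nonneg _)
  rw [← normSq_eq_norm_sq, ← normSq_eq_norm_sq, normSq_apply, normSq_apply]
  simp only [add_re, sub_re, one_re, add_im, sub_im, one_im]
  nlinarith

/-- If the ratio `ρ` of a pair lies in the closed right half plane, then the roots are not
equidistant from the arithmetic mean: the ratio `w` of the next pair satisfies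
`4 / w² = ρ + 1 / ρ + 2`, which has positive real part. -/
lemma re_ne_zero_of_re_nonneg {ρ w : ℂ} (hρ : ρ ≠ 0) (hre : 0 ≤ ρ.re)
    (hw : w ^ 2 * (1 + ρ) ^ 2 = 4 * ρ) : w.re ≠ 0 := by
  intro h
  have hwne : w ≠ 0 := by
    rintro rfl
    simp [hρ] at hw
  have e : 4 * (w ^ 2)⁻¹ = ρ + ρ⁻¹ + 2 := by
    field_simp; linear_combination -hw
  have h1 : 0 < (ρ + ρ⁻¹ + 2).re := by
    have : 0 ≤ (ρ⁻¹).re := by rw [inv_re]; exact div_nonneg hre (normSq_nonneg _)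
    rw [add_re, add_re, re_ofNat]; linarith
  have e2 : w = (w.im : ℂ) * I := by
    apply Complex.ext <;> simp [h]
  rw [← e, e2, mul_pow, I_sq, ← ofReal_pow, mul_neg_one, ← ofReal_neg, ← ofReal_inv] at h1
  rw [show (4 : ℂ) = ((4 : ℝ) : ℂ) by norm_num, ← ofReal_mul, ofReal_re, inv_neg] at h1
  have : 0 ≤ (w.im ^ 2)⁻¹ := by positivity
  linarith

/-- Near roots drive the ratio to `1`. A first tie is possible, but from the second step on
`Z = (a - g) / (a + g)` lies in the open unit disk, and then `|Z|` decreases quadratically. -/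
lemma tendsto_div_of_near {a g : ℕ → ℂ} (ha : ∀ n, a n ≠ 0) (hg : ∀ n, g n ≠ 0)
    (hs : ∀ n, a n + g n ≠ 0) (ha' : ∀ n, a (n + 1) = (a n + g n) / 2)
    (hg' : ∀ n, g (n + 1) = nearRoot (a n) (g n)) :
    Tendsto (fun n => g n / a n) atTop (𝓝 1) := by
  have hρ0 : ∀ n, g (n + 1) / a (n + 1) = 2 * (nearRoot (a n) (g n) / (a n + g n)) := by
    intro n; rw [ha', hg']; field_simp
  have hρ : ∀ n, 0 ≤ (g (n + 1) / a (n + 1)).re := by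
    intro n; rw [hρ0]; simpa using nearRoot_re_nonneg (a n) (g n)
  have hρ2 : 0 < (g 2 / a 2).re := by
    have h1 : 1 + g 1 / a 1 = (a 1 + g 1) / a 1 := by
      have := ha 1; field_simp
    refine lt_of_le_of_ne (hρ 1) (Ne.symm ?_)
    refine re_ne_zero_of_re_nonneg (div_ne_zero (hg 1) (ha 1)) (hρ 0) ?_
    · rw [hρ0, h1]
      have h2 := ha 1
      have h3 := hs 1
      have h4 := nearRoot_sq (a 1) (g 1)
      field_simp
      linear_combination 4 * h4
  set Z : ℕ → ℂ := fun n => (a n - g n) / (a n + g n) with hZ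
  have hstep : ∀ n, ‖Z (n + 1)‖ ≤ ‖Z n‖ ^ 2 := by
    intro n
    simp only [hZ]
    rw [ha', hg']
    exact norm_step_le (hs n) (nearRoot_sq _ _) (nearRoot_re_nonneg _ _)
  have hZ2 : ‖Z 2‖ < 1 := norm_div_lt_one (ha 2) (hs 2) hρ2
  have hgeo : ∀ n, ‖Z (n + 2)‖ ≤ ‖Z 2‖ ^ (n + 1) := by
    intro n
    induction n with
    | zero => simp
    | succ n ih =>
      refine (hstep _).trans ?_
      have h1 : ‖Z (n + 2)‖ ^ 2 ≤ (‖Z 2‖ ^ (n + 1)) ^ 2 := by gcongr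
      refine h1.trans ?_
      rw [← pow_mul]
      exact pow_le_pow_of_le_one (norm_nonneg _) hZ2.le (by omega)
  have hlim : Tendsto Z atTop (𝓝 0) := by
    rw [← tendsto_add_atTop_iff_nat 2]
    refine squeeze_zero_norm hgeo ?_
    exact (tendsto_pow_atTop_nhds_zero_of_lt_one (norm_nonneg _) hZ2).comp (tendsto_add_atTop_nat 1)
  have h1 : Tendsto (fun n => (1 - Z n) / (1 + Z n)) atTop (𝓝 ((1 - 0) / (1 + 0))) :=
    (hlim.const_sub 1).div (hlim.const_add 1) (by simp)
  rw [sub_zero, add_zero, div_one] at h1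
  refine h1.congr fun n => ?_
  have := ha n
  have e1 : 1 - Z n = 2 * g n / (a n + g n) := by simp only [hZ]; rw [one_sub_div (hs n)]; ring_nf
  have e2 : 1 + Z n = 2 * a n / (a n + g n) := by simp only [hZ]; rw [one_add_div (hs n)]; ring_nf
  rw [e1, e2, div_div_div_cancel_right₀ (hs n), mul_div_mul_left _ _ two_ne_zero]

end MultivaluedAGM

/-! ### Reduction of period bases -/

namespace MultivaluedAGM

open Complex

/-- The basis `(d u + c v, α u + β v)` is a period basis of `(± a, ± g)`, in this order if `α` is
even and in the other order if `α` is odd, where the signs of `a` and `g` are the residues of `d`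
and of `d + c` modulo `4`. The property holds for a period basis `(u, v)` of `(a, g)` itself and is
preserved by the moves `v ↦ v ± u` and `u ↦ u ± 2v`, so that it holds for every basis reached by
them. -/
def IsReachable (a g u v : ℂ) (d c α β : ℤ) : Prop :=
  ∃ ε ε' : ℤ, (ε = 1 ∨ ε = -1) ∧ (ε' = 1 ∨ ε' = -1) ∧ 4 ∣ d - ε ∧ 4 ∣ d + c - ε' ∧ ¬ 2 ∣ β ∧
    ((2 ∣ α ∧ IsPeriodBasis (ε * a) (ε' * g) (d * u + c * v) (α * u + β * v)) ∨
      (¬ 2 ∣ α ∧ IsPeriodBasis (ε' * g) (ε * a) (d * u + c * v) (α * u + β * v)))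

namespace IsReachable

variable {a g u v : ℂ} {d c α β : ℤ}

lemma translate (h : IsReachable a g u v d c α β) : IsReachable a g u v d c (α + d) (β + c) := by
  obtain ⟨ε, ε', h1, h2, h3, h4, h5, h6⟩ := h
  refine ⟨ε, ε', h1, h2, h3, h4, by omega, ?_⟩
  have e : ((α + d : ℤ) : ℂ) * u + ((β + c : ℤ) : ℂ) * v
      = (α * u + β * v) + (d * u + c * v) := by push_cast; ring
  rw [e]
  rcases h6 with ⟨h6, h7⟩ | ⟨h6, h7⟩
  · exact Or.inr ⟨by omega, h7.swap⟩
  · exact Or.inl ⟨by omega, h7.swap⟩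

lemma translate' (h : IsReachable a g u v d c α β) : IsReachable a g u v d c (α - d) (β - c) := by
  obtain ⟨ε, ε', h1, h2, h3, h4, h5, h6⟩ := h
  refine ⟨ε, ε', h1, h2, h3, h4, by omega, ?_⟩
  have e : ((α - d : ℤ) : ℂ) * u + ((β - c : ℤ) : ℂ) * v
      = (α * u + β * v) - (d * u + c * v) := by push_cast; ring
  rw [e]
  rcases h6 with ⟨h6, h7⟩ | ⟨h6, h7⟩
  · exact Or.inr ⟨by omega, h7.swap'⟩
  · exact Or.inl ⟨by omega, h7.swap'⟩

lemma translate_int (h : IsReachable a g u v d c α β) (j : ℤ) :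
    IsReachable a g u v d c (α + j * d) (β + j * c) := by
  induction j using Int.induction_on with
  | zero => simpa using h
  | succ n ih =>
    convert ih.translate using 1 <;> ring
  | pred n ih =>
    convert ih.translate' using 1 <;> ring

lemma shear (h : IsReachable a g u v d c α β) :
    IsReachable a g u v (d + 2 * α) (c + 2 * β) α β := by
  obtain ⟨ε, ε', h1, h2, h3, h4, h5, h6⟩ := h
  have e : ((d + 2 * α : ℤ) : ℂ) * u + ((c + 2 * β : ℤ) : ℂ) * v
      = (d * u + c * v) + 2 * (α * u + β * v) := by push_cast; ring
  rcases h6 with ⟨h6, h7⟩ | ⟨h6, h7⟩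
  · refine ⟨ε, -ε', h1, by omega, by omega, by omega, h5, Or.inl ⟨h6, ?_⟩⟩
    rw [e]
    simpa using h7.shear
  · refine ⟨-ε, ε', by omega, h2, by omega, by omega, h5, Or.inr ⟨h6, ?_⟩⟩
    rw [e]
    simpa using h7.shear

lemma shear' (h : IsReachable a g u v d c α β) :
    IsReachable a g u v (d - 2 * α) (c - 2 * β) α β := by
  obtain ⟨ε, ε', h1, h2, h3, h4, h5, h6⟩ := h
  have e : ((d - 2 * α : ℤ) : ℂ) * u + ((c - 2 * β : ℤ) : ℂ) * v
      = (d * u + c * v) - 2 * (α * u + β * v) := by push_cast; ring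
  rcases h6 with ⟨h6, h7⟩ | ⟨h6, h7⟩
  · refine ⟨ε, -ε', h1, by omega, by omega, by omega, h5, Or.inl ⟨h6, ?_⟩⟩
    rw [e]
    simpa using h7.shear'
  · refine ⟨-ε, ε', by omega, h2, by omega, by omega, h5, Or.inr ⟨h6, ?_⟩⟩
    rw [e]
    simpa using h7.shear'

end IsReachable

lemma IsPeriodBasis.isReachable {a g u v : ℂ} (h : IsPeriodBasis a g u v) :
    IsReachable a g u v 1 0 0 1 :=
  ⟨1, 1, by simp, by simp, by simp, by simp, by decide, Or.inl ⟨by simp, by simpa using h⟩⟩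

lemma finite_lattice_norm_le {u v : ℂ} (h : 0 < (v / u).im) (R : ℝ) :
    {p : ℤ × ℤ | ‖(p.1 : ℂ) * u + p.2 * v‖ ≤ R * ‖u‖}.Finite := by
  have hu := (ne_zero_of_im_div_pos h).1
  set τ := v / u with hτ
  set B : ℤ := ⌈R / τ.im⌉
  set A : ℤ := ⌈R + |(B : ℝ)| * ‖τ‖⌉
  refine ((Set.finite_Icc (-A) A).prod (Set.finite_Icc (-B) B)).subset ?_
  rintro ⟨d, c⟩ hp
  have hp' : ‖(d : ℂ) + c * τ‖ ≤ R := by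
    have e : (d : ℂ) * u + c * v = (d + c * τ) * u := by rw [hτ]; field_simp
    simp only [Set.mem_ofPred_eq, e, norm_mul] at hp
    exact le_of_mul_le_mul_right hp (norm_pos_iff.2 hu)
  have hc : |(c : ℝ)| ≤ B := by
    refine le_trans ?_ (Int.le_ceil _)
    rw [le_div_iff₀ h]
    have h1 := (abs_im_le_norm ((d : ℂ) + c * τ)).trans hp'
    simpa [abs_mul, abs_of_pos h] using h1
  have hd : |(d : ℝ)| ≤ A := by
    refine le_trans ?_ (Int.le_ceil _)
    have h1 : ‖(d : ℂ)‖ ≤ ‖(d : ℂ) + c * τ‖ + ‖(c : ℂ) * τ‖ := by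
      simpa using norm_sub_le ((d : ℂ) + c * τ) (c * τ)
    rw [norm_mul, Complex.norm_intCast, Complex.norm_intCast] at h1
    have h2 : |(c : ℝ)| * ‖τ‖ ≤ |(B : ℝ)| * ‖τ‖ :=
      mul_le_mul_of_nonneg_right (hc.trans (le_abs_self _)) (norm_nonneg _)
    linarith
  rw [abs_le] at hc hd
  simp only [Set.mem_prod, Set.mem_Icc]
  exact_mod_cast And.intro hd hc

/-- A point of the strip `|Re τ| ≤ 1/2` outside the disks `|τ ± 1/2| < 1/2` lies high, or close
enough to the cusp `0` for `-1/τ` to lie high. -/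
lemma half_le_im_or_one_le {τ : ℂ} (h0 : 0 < τ.im) (hre : |τ.re| ≤ 1 / 2)
    (h1 : 1 ≤ ‖1 + 2 * τ‖) (h2 : 1 ≤ ‖1 - 2 * τ‖) : 1 / 2 ≤ τ.im ∨ 1 ≤ (-1 / τ).im := by
  by_contra! hcon
  obtain ⟨h3, h4⟩ := hcon
  rw [im_neg_one_div, normSq_apply, div_lt_one (by nlinarith)] at h4
  have h1' : 1 ≤ normSq (1 + 2 * τ) := by rw [normSq_eq_norm_sq]; nlinarith
  have h2' : 1 ≤ normSq (1 - 2 * τ) := by rw [normSq_eq_norm_sq]; nlinarith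
  rw [normSq_apply] at h1' h2'
  simp at h1' h2'
  obtain ⟨h5, h6⟩ := abs_le.1 hre
  rcases le_or_gt |τ.re| τ.im with h7 | h7
  · obtain ⟨h8, h9⟩ := abs_le.1 h7
    nlinarith
  · rcases abs_cases τ.re with ⟨h8, h9⟩ | ⟨h8, h9⟩ <;> rw [h8] at h7 <;> nlinarith

namespace IsPeriodBasis

variable {a g u v : ℂ}

lemma one_sub_div_sq (h : IsPeriodBasis a g u v) :
    1 - (g / a) ^ 2 = (jacobiTheta (-1 / (v / u) + 1) / jacobiTheta (-1 / (v / u))) ^ 4 := by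
  have h1 := thetaSq_neg_one_div_add_one_sq _ h.im_pos
  have h2 := thetaSq_neg_one_div _ h.im_pos
  have h3 := thetaSq_ne_zero h.im_pos
  have h4 := thetaSq_ne_zero (im_neg_one_div_pos h.im_pos)
  have h5 : thetaSq (-1 / (v / u)) ^ 2 = -(v / u) ^ 2 * thetaSq (v / u) ^ 2 := by
    rw [h2]; linear_combination ((v / u) ^ 2 * thetaSq (v / u) ^ 2) * I_sq
  have e : (jacobiTheta (-1 / (v / u) + 1) / jacobiTheta (-1 / (v / u))) ^ 4 =
      thetaSq (-1 / (v / u) + 1) ^ 2 / thetaSq (-1 / (v / u)) ^ 2 := by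
    rw [thetaSq, thetaSq, div_pow]; ring
  have hτ : (v / u) ≠ 0 := div_ne_zero h.right_ne_zero h.left_ne_zero
  rw [h.div_eq, e, h1, h5]
  generalize v / u = τ at *
  field_simp

/-- Close to the cusp `0` the ratio of the pair stays away from `±1`. -/
lemma le_norm_one_sub_div_sq (h : IsPeriodBasis a g u v) (him : 1 ≤ (-1 / (v / u)).im) :
    2 / 5 ≤ ‖1 - (g / a) ^ 2‖ := by
  rw [h.one_sub_div_sq, norm_pow, norm_div]
  have h1 := norm_jacobiTheta_sub_one_le_of_one_le him
  have h2 := norm_jacobiTheta_sub_one_le_of_one_le (τ := -1 / (v / u) + 1) (by simpa using him)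
  have h0 := jacobiTheta_ne_zero (im_neg_one_div_pos h.im_pos)
  set x := jacobiTheta (-1 / (v / u))
  set y := jacobiTheta (-1 / (v / u) + 1)
  have h3 : 8 / 9 ≤ ‖y‖ := by
    have := norm_sub_norm_le (1 : ℂ) (1 - y)
    rw [norm_sub_rev] at h2
    simp at this; linarith
  have h4 : ‖x‖ ≤ 10 / 9 := by
    have := norm_le_norm_add_norm_sub (1 : ℂ) x
    rw [norm_sub_rev] at this
    simp at this; linarith
  have h5 : 4 / 5 ≤ ‖y‖ / ‖x‖ := by
    rw [le_div_iff₀ (norm_pos_iff.2 h0)]; linarith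
  calc (2 / 5 : ℝ) ≤ (4 / 5) ^ 4 := by norm_num
    _ ≤ _ := by gcongr

/-- High in the upper half plane the ratio of the pair stays away from `-1`. -/
lemma le_norm_one_add_div (h : IsPeriodBasis a g u v) (him : 1 / 2 ≤ (v / u).im) :
    1 / 2 ≤ ‖1 + g / a‖ := by
  have h0 := thetaSq_ne_zero h.im_pos
  have e : 1 + g / a = 2 * thetaSq (2 * (v / u)) / thetaSq (v / u) := by
    rw [h.div_eq, ← thetaSq_add _ h.im_pos]
    field_simp
  have h1 := norm_jacobiTheta_sub_one_le_of_half_le him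
  have h2 := norm_jacobiTheta_sub_one_le_of_one_le (τ := 2 * (v / u)) (by
    have := im_two_pow_mul 1 (v / u)
    rw [pow_one, pow_one] at this
    linarith)
  rw [e, norm_div, norm_mul, le_div_iff₀ (norm_pos_iff.2 h0), thetaSq, thetaSq, norm_pow, norm_pow]
  set x := jacobiTheta (v / u)
  set y := jacobiTheta (2 * (v / u))
  have h3 : 8 / 9 ≤ ‖y‖ := by
    have := norm_sub_norm_le (1 : ℂ) (1 - y)
    rw [norm_sub_rev] at h2
    simp at this; linarith
  have h4 : ‖x‖ ≤ 8 / 5 := by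
    have := norm_le_norm_add_norm_sub (1 : ℂ) x
    rw [norm_sub_rev] at this
    simp at this; linarith
  have h5 := norm_nonneg x
  rw [Complex.norm_two]
  nlinarith

/-- A basis whose first member has least absolute value, translated into the strip
`|Re τ| ≤ 1/2`, lies outside the disks `|τ ± 1/2| < 1/2`. -/
lemma exists_reduced (h : IsPeriodBasis a g u v) :
    ∃ d c α β : ℤ, IsReachable a g u v d c α β ∧
      (1 / 2 ≤ ((α * u + β * v) / (d * u + c * v)).im ∨
        1 ≤ (-1 / ((α * u + β * v) / (d * u + c * v))).im) := by
  have hfin : {p : ℤ × ℤ | (∃ α β, IsReachable a g u v p.1 p.2 α β) ∧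
      ‖(p.1 : ℂ) * u + p.2 * v‖ ≤ 1 * ‖u‖}.Finite :=
    (finite_lattice_norm_le h.im_pos 1).subset fun p hp => hp.2
  obtain ⟨⟨d, c⟩, ⟨⟨α, β, hr⟩, hle⟩, hmin⟩ := Set.exists_min_image _
    (fun p : ℤ × ℤ => ‖(p.1 : ℂ) * u + p.2 * v‖) hfin ⟨(1, 0), ⟨0, 1, h.isReachable⟩, by simp⟩
  have hmin' : ∀ d' c' α' β', IsReachable a g u v d' c' α' β' →
      ‖(d : ℂ) * u + c * v‖ ≤ ‖(d' : ℂ) * u + c' * v‖ := by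
    intro d' c' α' β' hr'
    by_cases hle' : ‖(d' : ℂ) * u + c' * v‖ ≤ 1 * ‖u‖
    · exact hmin (d', c') ⟨⟨α', β', hr'⟩, hle'⟩
    · exact hle.trans (not_le.1 hle').le
  set j : ℤ := -round ((α * u + β * v) / (d * u + c * v)).re with hj
  have hr2 := hr.translate_int j
  set w := (d : ℂ) * u + c * v with hw
  have hpos : 0 < (((α + j * d : ℤ) * u + (β + j * c : ℤ) * v) / w).im ∧ w ≠ 0 := by
    obtain ⟨ε, ε', -, -, -, -, -, ⟨-, h7⟩ | ⟨-, h7⟩⟩ := hr2 <;>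
      exact ⟨h7.im_pos, h7.left_ne_zero⟩
  obtain ⟨hpos, hw0⟩ := hpos
  have h1 := hmin' _ _ _ _ hr2.shear
  have h2 := hmin' _ _ _ _ hr2.shear'
  refine ⟨d, c, _, _, hr2, ?_⟩
  have e : ((α + j * d : ℤ) * u + (β + j * c : ℤ) * v) / w = (α * u + β * v) / w + j := by
    rw [div_add' _ _ _ hw0]; congr 1; rw [hw]; push_cast; ring
  set τ := ((α + j * d : ℤ) * u + (β + j * c : ℤ) * v) / w with hτ
  have hτw : τ * w = (α + j * d : ℤ) * u + (β + j * c : ℤ) * v := div_mul_cancel₀ _ hw0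
  have e1 : ((d + 2 * (α + j * d) : ℤ) : ℂ) * u + (c + 2 * (β + j * c) : ℤ) * v
      = (1 + 2 * τ) * w := by
    rw [add_mul, one_mul, mul_assoc, hτw, hw]
    push_cast; ring
  have e2 : ((d - 2 * (α + j * d) : ℤ) : ℂ) * u + (c - 2 * (β + j * c) : ℤ) * v
      = (1 - 2 * τ) * w := by
    rw [sub_mul, one_mul, mul_assoc, hτw, hw]
    push_cast; ring
  rw [e1, norm_mul] at h1
  rw [e2, norm_mul] at h2
  have hwn := norm_pos_iff.2 hw0
  refine half_le_im_or_one_le hpos ?_ ?_ ?_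
  · rw [e, hj, add_re, intCast_re, Int.cast_neg, ← sub_eq_add_neg]
    exact abs_sub_round _
  · exact le_of_mul_le_mul_right (by linarith) hwn
  · exact le_of_mul_le_mul_right (by linarith) hwn

/-- A pair with ratio close to `1` has a period basis high in the upper half plane, and its first
member lies in the expected coset: the signs recorded by `IsReachable` must agree, because
otherwise the ratio would be close to `-1`. -/
lemma exists_high (h : IsPeriodBasis a g u v) (h1 : ‖g / a - 1‖ ≤ 1 / 100)
    (h2 : ‖a / g - 1‖ ≤ 1 / 100) :
    ∃ (d c : ℤ) (z : ℂ), 4 ∣ d - 1 ∧ 4 ∣ c ∧ IsPeriodBasis a g (d * u + c * v) z ∧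
      1 / 2 ≤ (z / (d * u + c * v)).im := by
  have aux : ∀ {A G w z : ℂ} {ε ε' : ℤ}, IsPeriodBasis (ε * A) (ε' * G) w z →
      (ε = 1 ∨ ε = -1) → (ε' = 1 ∨ ε' = -1) → ‖G / A - 1‖ ≤ 1 / 100 →
      (1 / 2 ≤ (z / w).im ∨ 1 ≤ (-1 / (z / w)).im) → 1 / 2 ≤ (z / w).im ∧ ε' = ε := by
    intro A G w z ε ε' hb hε hε' hAG hz
    have hsq : ((ε' * G : ℂ) / (ε * A)) ^ 2 = (G / A) ^ 2 := by
      rcases hε with rfl | rfl <;> rcases hε' with rfl | rfl <;> simp [div_neg, neg_div]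
    have hz' : 1 / 2 ≤ (z / w).im := by
      rcases hz with hz | hz
      · exact hz
      exfalso
      have h3 := hb.le_norm_one_sub_div_sq hz
      rw [hsq] at h3
      set t := G / A - 1 with ht
      have e : 1 - (G / A) ^ 2 = -(t * (t + 2)) := by rw [ht]; ring
      have h4 : ‖t + 2‖ ≤ 3 := by
        have := norm_add_le t 2
        rw [Complex.norm_two] at this
        linarith
      rw [e, norm_neg, norm_mul] at h3
      nlinarith [norm_nonneg t, norm_nonneg (t + 2)]
    refine ⟨hz', ?_⟩
    by_contra hne
    have h3 := hb.le_norm_one_add_div hz'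
    have e : 1 + (ε' * G : ℂ) / (ε * A) = -(G / A - 1) := by
      rcases hε with rfl | rfl <;> rcases hε' with rfl | rfl
      · exact absurd rfl hne
      · push_cast; ring
      · push_cast; ring
      · exact absurd rfl hne
    rw [e, norm_neg] at h3
    linarith
  have aux2 : ∀ {A G w z : ℂ} {ε : ℤ}, IsPeriodBasis (ε * A) (ε * G) w z → (ε = 1 ∨ ε = -1) →
      IsPeriodBasis A G (ε * w) (ε * z) := by
    rintro A G w z ε hb (rfl | rfl)
    · simpa using hb
    · simpa using hb.neg
  obtain ⟨d, c, α, β, ⟨ε, ε', h3, h4, h5, h6, h7, h8⟩, h9⟩ := h.exists_reduced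
  have e0 : ∀ ε : ℤ, (ε = 1 ∨ ε = -1) → ((ε * d : ℤ) : ℂ) * u + (ε * c : ℤ) * v =
      ε * (d * u + c * v) ∧ ((ε : ℤ) : ℂ) ≠ 0 ∧ (4 ∣ d - ε → 4 ∣ d + c - ε →
        4 ∣ ε * d - 1 ∧ 4 ∣ ε * c) := by
    rintro ε (rfl | rfl)
    · exact ⟨by push_cast; ring, by norm_num, fun _ _ => by omega⟩
    · exact ⟨by push_cast; ring, by norm_num, fun _ _ => by omega⟩
  obtain ⟨e1, e2, e3⟩ := e0 ε h3
  rcases h8 with ⟨-, h8⟩ | ⟨-, h8⟩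
  · obtain ⟨h10, rfl⟩ := aux h8 h3 h4 h1 h9
    refine ⟨ε' * d, ε' * c, ε' * (α * u + β * v), (e3 h5 h6).1, (e3 h5 h6).2, ?_, ?_⟩
    · rw [e1]; exact aux2 h8 h3
    · rwa [e1, mul_div_mul_left _ _ e2]
  · obtain ⟨h10, rfl⟩ := aux h8 h4 h3 h2 h9
    have h11 := (aux2 h8 h3).swap
    refine ⟨ε * d, ε * c, ε * (α * u + β * v) + ε * (d * u + c * v), (e3 h5 h6).1,
      (e3 h5 h6).2, ?_, ?_⟩
    · rw [e1]; exact h11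
    · rwa [e1, im_div_add_self _ (mul_ne_zero e2 h8.left_ne_zero), mul_div_mul_left _ _ e2]

/-- For every admissible sign sequence the mean exists, and `π / (2 AGM)` lies in the coset
`u + 4 (ℤ u + ℤ v)`. -/
theorem exists_hasAGM (h : IsPeriodBasis a g u v) {σ : ℕ → ℤˣ} (hσ : FinitelyManyFlips σ) :
    ∃ d c : ℤ, 4 ∣ d - 1 ∧ 4 ∣ c ∧ (d * u + c * v : ℂ) ≠ 0 ∧
      HasAGM σ a g (Real.pi / (2 * (d * u + c * v))) := by
  obtain ⟨N, hN⟩ := eventually_atTop.1 hσ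
  set x : ℕ → ℂ := fun n => (agmSeq σ a g n).1
  set y : ℕ → ℂ := fun n => (agmSeq σ a g n).2
  have hb : ∀ n, ∃ c : ℤ, IsPeriodBasis (x n) (y n) (u + (4 * c : ℤ) * v) (2 ^ n * v) :=
    h.exists_agmSeq σ
  have hx : ∀ n, x n ≠ 0 := fun n => (hb n).choose_spec.fst_ne_zero
  have hy : ∀ n, y n ≠ 0 := fun n => (hb n).choose_spec.snd_ne_zero
  have hxy : ∀ n, x n + y n ≠ 0 := fun n => (hb n).choose_spec.add_ne_zero
  have hlim : Tendsto (fun n => y (N + n) / x (N + n)) atTop (𝓝 1) := by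
    apply tendsto_div_of_near (a := fun n => x (N + n)) (g := fun n => y (N + n))
      (fun n => hx _) (fun n => hy _) (fun n => hxy _)
    · intro n; rfl
    · intro n
      change ((σ (N + n) : ℤ) : ℂ) * nearRoot (x (N + n)) (y (N + n)) = _
      rw [hN _ (by omega)]
      simp
  have hlim' : Tendsto (fun n => x (N + n) / y (N + n)) atTop (𝓝 1) := by
    simpa using hlim.inv₀ one_ne_zero
  have hball := Metric.closedBall_mem_nhds (1 : ℂ) (ε := 1 / 100) (by norm_num)
  have hev := (hlim.eventually hball).and (hlim'.eventually hball)
  obtain ⟨n, hn1, hn2⟩ := hev.exists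
  rw [dist_eq_norm] at hn1 hn2
  obtain ⟨c₀, hc₀⟩ := hb (N + n)
  obtain ⟨d, c, z, hd, hc, hz, him⟩ := hc₀.exists_high hn1 hn2
  have hM := hz.hasAGM_one_of_half_le him
  have e : (d : ℂ) * (u + (4 * c₀ : ℤ) * v) + c * (2 ^ (N + n) * v) =
      d * u + (d * (4 * c₀) + c * 2 ^ (N + n) : ℤ) * v := by push_cast; ring
  rw [e] at hM hz
  refine ⟨d, d * (4 * c₀) + c * 2 ^ (N + n), hd, ?_, hz.left_ne_zero, ?_⟩
  · exact dvd_add (Dvd.intro (d * c₀) (by ring)) (hc.mul_right _)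
  · refine hasAGM_of_tail (N + n) ?_
    have e1 : (fun k => σ (N + n + k)) = 1 := by
      funext k; exact hN _ (by omega)
    rw [e1]
    exact hM

end IsPeriodBasis
end MultivaluedAGM

/-! ### The complete elliptic integral -/

namespace MultivaluedAGM

open Complex

section Integral

open MeasureTheory Set

/-- Gauss's integral `∫₀^∞ dt / √((t² + a²)(t² + g²))`, invariant under the arithmetic-geometric
step. -/
noncomputable def gaussIntegral (a g : ℝ) : ℝ :=
  ∫ t in Ioi (0 : ℝ), 1 / √((t ^ 2 + a ^ 2) * (t ^ 2 + g ^ 2))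

/-- The substitution `t = b tan θ`. -/
lemma ellipticK_eq_gaussIntegral {k b : ℝ} (hb : 0 < b) (hkb : k ^ 2 + b ^ 2 = 1) :
    ellipticK k = gaussIntegral 1 b := by
  have himg : (fun θ => b * Real.tan θ) '' Ioo 0 (Real.pi / 2) = Ioi 0 := by
    ext t
    simp only [mem_image, mem_Ioo, mem_Ioi]
    constructor
    · rintro ⟨θ, ⟨h0, h1⟩, rfl⟩
      exact mul_pos hb (Real.tan_pos_of_pos_of_lt_pi_div_two h0 h1)
    · intro ht
      refine ⟨Real.arctan (t / b),
        ⟨Real.arctan_pos.2 (by positivity), Real.arctan_lt_pi_div_two _⟩, ?_⟩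
      rw [Real.tan_arctan]; field_simp
  have hcos : ∀ θ ∈ Ioo (0 : ℝ) (Real.pi / 2), 0 < Real.cos θ := fun θ hθ =>
    Real.cos_pos_of_mem_Ioo ⟨by linarith [hθ.1, Real.pi_pos], hθ.2⟩
  have hder : ∀ θ ∈ Ioo (0 : ℝ) (Real.pi / 2), HasDerivWithinAt (fun θ => b * Real.tan θ)
      (b * (1 / Real.cos θ ^ 2)) (Ioo 0 (Real.pi / 2)) θ := fun θ hθ =>
    ((Real.hasDerivAt_tan (hcos θ hθ).ne').const_mul b).hasDerivWithinAt
  have hinj : InjOn (fun θ => b * Real.tan θ) (Ioo 0 (Real.pi / 2)) := by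
    intro x hx y hy hxy
    refine Real.injOn_tan ⟨by linarith [hx.1, Real.pi_pos], hx.2⟩
      ⟨by linarith [hy.1, Real.pi_pos], hy.2⟩ (mul_left_cancel₀ hb.ne' hxy)
  rw [gaussIntegral, ← himg, integral_image_eq_integral_abs_deriv_smul measurableSet_Ioo hder hinj,
    ellipticK, intervalIntegral.integral_of_le (by positivity), integral_Ioc_eq_integral_Ioo]
  refine setIntegral_congr_fun measurableSet_Ioo fun θ hθ => ?_
  have hc := hcos θ hθ
  have hsc := Real.sin_sq_add_cos_sq θ
  simp only [smul_eq_mul]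
  rw [abs_of_pos (by positivity), Real.tan_eq_sin_div_cos]
  have e : ((b * (Real.sin θ / Real.cos θ)) ^ 2 + 1 ^ 2) *
      ((b * (Real.sin θ / Real.cos θ)) ^ 2 + b ^ 2) =
      (1 - k ^ 2 * Real.sin θ ^ 2) * (b / Real.cos θ ^ 2) ^ 2 := by
    have hk : k ^ 2 = 1 - b ^ 2 := by linarith
    have hs : Real.sin θ ^ 2 = 1 - Real.cos θ ^ 2 := by linarith
    rw [hk]
    field_simp
    rw [hs]; ring
  have hpos : 0 < b / Real.cos θ ^ 2 := by positivity
  rw [e, Real.sqrt_mul' _ (by positivity), Real.sqrt_sq hpos.le, mul_one_div, mul_one_div,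
    mul_comm (√_), div_mul_cancel_left₀ hpos.ne', one_div]

/-- Gauss's invariance, by the substitution `x = (t - a g / t) / 2` from `(0, ∞)` onto `ℝ`. -/
lemma gaussIntegral_step {a g r : ℝ} (ha : 0 < a) (hg : 0 < g) (hr : r ^ 2 = a * g) :
    gaussIntegral ((a + g) / 2) r = gaussIntegral a g := by
  set F : ℝ → ℝ := fun x => 1 / √((x ^ 2 + ((a + g) / 2) ^ 2) * (x ^ 2 + r ^ 2)) with hF
  have hag : 0 < a * g := mul_pos ha hg
  have heven : ∫ x, F x = 2 * gaussIntegral ((a + g) / 2) r := by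
    have := integral_comp_abs (f := F)
    simpa only [hF, sq_abs, gaussIntegral] using this
  set φ : ℝ → ℝ := fun t => (t - a * g / t) / 2 with hφ
  have himg : φ '' Ioi 0 = univ := by
    refine eq_univ_of_forall fun x => ⟨x + √(x ^ 2 + a * g), ?_, ?_⟩
    · have : |x| < √(x ^ 2 + a * g) := by
        rw [← Real.sqrt_sq_eq_abs]
        exact Real.sqrt_lt_sqrt (sq_nonneg _) (by linarith)
      have := neg_abs_le x
      simp only [mem_Ioi]; linarith
    · have h1 : |x| < √(x ^ 2 + a * g) := by
        rw [← Real.sqrt_sq_eq_abs]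
        exact Real.sqrt_lt_sqrt (sq_nonneg _) (by linarith)
      have h2 := neg_abs_le x
      have h3 : x + √(x ^ 2 + a * g) ≠ 0 := by linarith
      have h4 : √(x ^ 2 + a * g) ^ 2 = x ^ 2 + a * g := Real.sq_sqrt (by positivity)
      simp only [hφ]
      field_simp
      linear_combination h4
  have hder : ∀ t ∈ Ioi (0 : ℝ), HasDerivWithinAt φ ((1 + a * g / t ^ 2) / 2) (Ioi 0) t := by
    intro t ht
    have ht' : t ≠ 0 := (mem_Ioi.1 ht).ne'
    have h1 := ((hasDerivAt_id t).sub ((hasDerivAt_inv ht').const_mul (a * g))).div_const 2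
    have h2 : φ = fun t => (id t - a * g * t⁻¹) / 2 := by
      funext t; simp [hφ, div_eq_mul_inv]
    rw [h2]
    refine (h1.congr_deriv ?_).hasDerivWithinAt
    rw [div_eq_mul_inv (a * g)]; ring
  have hinj : InjOn φ (Ioi 0) := by
    intro x hx y hy hxy
    have hx' : 0 < x := hx
    have hy' : 0 < y := hy
    simp only [hφ] at hxy
    field_simp at hxy
    have h1 : (x - y) * (x * y + a * g) = 0 := by linear_combination hxy
    have h2 : x * y + a * g ≠ 0 := by positivity
    rcases mul_eq_zero.1 h1 with h3 | h3
    · linarith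
    · exact absurd h3 h2
  have hsub := integral_image_eq_integral_abs_deriv_smul measurableSet_Ioi hder hinj F
  rw [himg, setIntegral_univ, heven] at hsub
  have hcongr : ∫ t in Ioi (0 : ℝ), |(1 + a * g / t ^ 2) / 2| • F (φ t) =
      ∫ t in Ioi (0 : ℝ), 2 * (1 / √((t ^ 2 + a ^ 2) * (t ^ 2 + g ^ 2))) := by
    refine setIntegral_congr_fun measurableSet_Ioi fun t ht => ?_
    have ht' : 0 < t := ht
    simp only [hF, hφ, smul_eq_mul]
    rw [abs_of_pos (by positivity)]
    have e : (((t - a * g / t) / 2) ^ 2 + ((a + g) / 2) ^ 2) *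
        (((t - a * g / t) / 2) ^ 2 + r ^ 2) =
        ((t ^ 2 + a ^ 2) * (t ^ 2 + g ^ 2)) * ((t ^ 2 + a * g) / (4 * t ^ 2)) ^ 2 := by
      rw [hr]
      field_simp
      ring
    rw [e, Real.sqrt_mul (by positivity), Real.sqrt_sq (by positivity)]
    have : 0 < √((t ^ 2 + a ^ 2) * (t ^ 2 + g ^ 2)) := by positivity
    field_simp
    ring
  rw [hcongr, integral_const_mul] at hsub
  exact mul_left_cancel₀ two_ne_zero hsub

lemma gaussIntegral_one_one : gaussIntegral 1 1 = Real.pi / 2 := by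
  have h := integral_Ioi_inv_one_add_sq (i := 0)
  rw [Real.arctan_zero, sub_zero] at h
  rw [← h, gaussIntegral]
  refine setIntegral_congr_fun measurableSet_Ioi fun t _ => ?_
  rw [← sq, Real.sqrt_sq (by positivity), one_div, one_pow, add_comm]

lemma tendsto_gaussIntegral {a g : ℕ → ℝ} (ha : Tendsto a atTop (𝓝 1))
    (hg : Tendsto g atTop (𝓝 1)) :
    Tendsto (fun n => gaussIntegral (a n) (g n)) atTop (𝓝 (gaussIntegral 1 1)) := by
  refine tendsto_integral_filter_of_dominated_convergence (fun t => 4 * (1 + t ^ 2)⁻¹) ?_ ?_ ?_ ?_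
  · refine Eventually.of_forall fun n => Measurable.aestronglyMeasurable (by fun_prop)
  · filter_upwards [ha.eventually (lt_mem_nhds (by norm_num : (1 / 2 : ℝ) < 1)),
      hg.eventually (lt_mem_nhds (by norm_num : (1 / 2 : ℝ) < 1))] with n han hgn
    refine Eventually.of_forall fun t => ?_
    rw [Real.norm_of_nonneg (by positivity)]
    have h1 : (1 + t ^ 2) / 4 ≤ √((t ^ 2 + a n ^ 2) * (t ^ 2 + g n ^ 2)) := by
      apply Real.le_sqrt_of_sq_le
      rw [sq]
      apply mul_le_mul <;> nlinarith [sq_nonneg t]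
    have h2 : (0 : ℝ) < (1 + t ^ 2) / 4 := by positivity
    calc 1 / √((t ^ 2 + a n ^ 2) * (t ^ 2 + g n ^ 2)) ≤ 1 / ((1 + t ^ 2) / 4) :=
          one_div_le_one_div_of_le h2 h1
      _ = 4 * (1 + t ^ 2)⁻¹ := by field_simp
  · exact (integrable_inv_one_add_sq.const_mul 4).integrableOn
  · refine Eventually.of_forall fun t => ?_
    have hpos : √((t ^ 2 + 1 ^ 2) * (t ^ 2 + 1 ^ 2)) ≠ 0 := by positivity
    exact tendsto_const_nhds.div
      (((ha.pow 2).const_add (t ^ 2)).mul ((hg.pow 2).const_add (t ^ 2))).sqrt hpos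

lemma gaussIntegral_mul {c : ℝ} (hc : 0 < c) (a g : ℝ) :
    c * gaussIntegral (c * a) (c * g) = gaussIntegral a g := by
  have h := integral_comp_mul_left_Ioi
    (fun t => 1 / √((t ^ 2 + (c * a) ^ 2) * (t ^ 2 + (c * g) ^ 2))) 0 hc
  rw [mul_zero, smul_eq_mul] at h
  have e : ∀ t : ℝ, 1 / √(((c * t) ^ 2 + (c * a) ^ 2) * ((c * t) ^ 2 + (c * g) ^ 2)) =
      (c ^ 2)⁻¹ * (1 / √((t ^ 2 + a ^ 2) * (t ^ 2 + g ^ 2))) := by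
    intro t
    rw [show ((c * t) ^ 2 + (c * a) ^ 2) * ((c * t) ^ 2 + (c * g) ^ 2) =
      (c ^ 2) ^ 2 * ((t ^ 2 + a ^ 2) * (t ^ 2 + g ^ 2)) by ring, Real.sqrt_mul (by positivity),
      Real.sqrt_sq (by positivity), one_div, mul_inv, one_div]
  simp only [e] at h
  rw [integral_const_mul] at h
  change (c ^ 2)⁻¹ * gaussIntegral a g = c⁻¹ * gaussIntegral (c * a) (c * g) at h
  field_simp at h
  linarith

end Integral

/-! ### Theta functions on the imaginary axis -/

/-- `θ₃(it)²` as a real number. -/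
noncomputable def thetaA (t : ℝ) : ℝ := (thetaSq (t * I)).re

/-- `θ₄(it)²` as a real number. -/
noncomputable def thetaB (t : ℝ) : ℝ := (thetaSq (t * I + 1)).re

/-- A theta constant fixed under `τ ↦ -conj τ` is real, so that its square is positive. -/
lemma thetaSq_real_of_conj {τ : ℂ} (hτ : 0 < τ.im)
    (h : jacobiTheta (-(starRingEnd ℂ) τ) = jacobiTheta τ) :
    0 < (thetaSq τ).re ∧ thetaSq τ = ((thetaSq τ).re : ℂ) := by
  have h1 := jacobiTheta₂_conj 0 τ
  rw [map_zero, ← jacobiTheta_eq_jacobiTheta₂, ← jacobiTheta_eq_jacobiTheta₂, h] at h1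
  obtain ⟨r, hr⟩ := conj_eq_iff_real.1 h1
  have h0 := jacobiTheta_ne_zero hτ
  rw [hr] at h0
  have hr0 : r ≠ 0 := by exact_mod_cast h0
  have e : thetaSq τ = ((r ^ 2 : ℝ) : ℂ) := by rw [thetaSq, hr]; push_cast; rfl
  rw [e, ofReal_re]
  exact ⟨by positivity, rfl⟩

section

variable {t : ℝ}

lemma thetaA_spec (ht : 0 < t) : 0 < thetaA t ∧ thetaSq (t * I) = (thetaA t : ℂ) :=
  thetaSq_real_of_conj (by simpa using ht) (by simp)

lemma thetaB_spec (ht : 0 < t) : 0 < thetaB t ∧ thetaSq (t * I + 1) = (thetaB t : ℂ) := by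
  refine thetaSq_real_of_conj (by simpa using ht) ?_
  rw [← jacobiTheta_two_add]
  congr 1
  simp
  ring

lemma thetaA_add_thetaB (ht : 0 < t) : (thetaA t + thetaB t) / 2 = thetaA (2 * t) := by
  have h := thetaSq_add (t * I) (by simpa using ht)
  rw [(thetaA_spec ht).2, (thetaB_spec ht).2,
    show (2 * (t * I) : ℂ) = ((2 * t : ℝ) : ℂ) * I by push_cast; ring,
    (thetaA_spec (by positivity : 0 < 2 * t)).2] at h
  have h' : thetaA t + thetaB t = 2 * thetaA (2 * t) := by exact_mod_cast h
  linarith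

lemma thetaA_mul_thetaB (ht : 0 < t) : thetaB (2 * t) ^ 2 = thetaA t * thetaB t := by
  have h := thetaSq_mul (t * I) (by simpa using ht)
  rw [(thetaA_spec ht).2, (thetaB_spec ht).2,
    show (2 * (t * I) + 1 : ℂ) = ((2 * t : ℝ) : ℂ) * I + 1 by push_cast; ring,
    (thetaB_spec (by positivity : 0 < 2 * t)).2] at h
  exact_mod_cast h.symm

lemma neg_one_div_mul_I (t : ℝ) : -1 / ((t : ℂ) * I) = ((1 / t : ℝ) : ℂ) * I := by
  rw [neg_div, one_div, mul_inv, inv_I]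
  push_cast; ring

lemma thetaA_inv (ht : 0 < t) : thetaA (1 / t) = t * thetaA t := by
  have h := thetaSq_neg_one_div (t * I) (by simpa using ht)
  rw [neg_one_div_mul_I, (thetaA_spec ht).2, (thetaA_spec (one_div_pos.2 ht)).2] at h
  have h' : (thetaA (1 / t) : ℂ) = ((t * thetaA t : ℝ) : ℂ) := by
    rw [h]; push_cast; linear_combination (-(t : ℂ) * thetaA t) * I_sq
  exact_mod_cast h'

lemma thetaB_inv_sq (ht : 0 < t) :
    thetaB (1 / t) ^ 2 = t ^ 2 * (thetaA t ^ 2 - thetaB t ^ 2) := by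
  have h := thetaSq_neg_one_div_add_one_sq (t * I) (by simpa using ht)
  rw [neg_one_div_mul_I, (thetaA_spec ht).2, (thetaB_spec ht).2,
    (thetaB_spec (one_div_pos.2 ht)).2] at h
  have h' : (thetaB (1 / t) ^ 2 : ℂ) = ((t ^ 2 * (thetaA t ^ 2 - thetaB t ^ 2) : ℝ) : ℂ) := by
    rw [h]; push_cast
    linear_combination (-(t : ℂ) ^ 2 * (thetaA t ^ 2 - thetaB t ^ 2)) * I_sq
  exact_mod_cast h'

lemma tendsto_thetaA (ht : 0 < t) : Tendsto (fun n : ℕ => thetaA (2 ^ n * t)) atTop (𝓝 1) := by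
  have h := tendsto_thetaSq (tendsto_two_pow_mul_im (z := t * I) (by simpa using ht))
  refine ((continuous_re.tendsto _).comp h).congr fun n => ?_
  simp only [Function.comp, thetaA]
  congr 2; push_cast; ring

lemma tendsto_thetaB (ht : 0 < t) : Tendsto (fun n : ℕ => thetaB (2 ^ n * t)) atTop (𝓝 1) := by
  have h := tendsto_thetaSq (x := fun n => 2 ^ n * (t * I) + 1)
    (by simpa using tendsto_two_pow_mul_im (z := t * I) (by simpa using ht))
  refine ((continuous_re.tendsto _).comp h).congr fun n => ?_
  simp only [Function.comp, thetaB]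
  congr 2; push_cast; ring

/-- Gauss's integral is constant along the iteration, whose limit on the imaginary axis is `(1, 1)`.
-/
lemma gaussIntegral_theta (ht : 0 < t) : gaussIntegral (thetaA t) (thetaB t) = Real.pi / 2 := by
  have h : ∀ n : ℕ, gaussIntegral (thetaA (2 ^ n * t)) (thetaB (2 ^ n * t)) =
      gaussIntegral (thetaA t) (thetaB t) := by
    intro n
    induction n with
    | zero => simp
    | succ n ih =>
      have hn : 0 < 2 ^ n * t := by positivity
      rw [← ih, pow_succ', mul_assoc, ← thetaA_add_thetaB hn]
      exact gaussIntegral_step (thetaA_spec hn).1 (thetaB_spec hn).1 (thetaA_mul_thetaB hn)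
  have h1 := tendsto_gaussIntegral (tendsto_thetaA ht) (tendsto_thetaB ht)
  simp only [h] at h1
  rw [← gaussIntegral_one_one]
  exact tendsto_nhds_unique tendsto_const_nhds h1

lemma ellipticK_eq_thetaA (ht : 0 < t) {k b : ℝ} (hb : 0 < b) (hkb : k ^ 2 + b ^ 2 = 1)
    (htb : thetaB t = b * thetaA t) : ellipticK k = Real.pi / 2 * thetaA t := by
  have h := gaussIntegral_mul (thetaA_spec ht).1 1 b
  rw [mul_one, mul_comm _ b, ← htb, gaussIntegral_theta ht] at h
  rw [ellipticK_eq_gaussIntegral hb hkb, ← h, mul_comm]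

/-- Every `b` in `(0, 1)` is a quotient `θ₄² / θ₃²` on the imaginary axis, by the intermediate
value theorem: the quotient tends to `1` at `i∞`, and `t ↦ 1/t` complements its square. -/
lemma exists_thetaB_eq {b : ℝ} (hb0 : 0 < b) (hb1 : b < 1) :
    ∃ t : ℝ, 0 < t ∧ thetaB t = b * thetaA t := by
  set q : ℝ → ℝ := fun t => thetaB t / thetaA t with hq
  have hcont : ContinuousOn q (Set.Ioi 0) := by
    intro t ht
    have ht' : 0 < t := ht
    refine ContinuousAt.continuousWithinAt (ContinuousAt.div ?_ ?_ (thetaA_spec ht').1.ne')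
    · have h1 : ContinuousAt thetaSq (t * I + 1) := continuousAt_thetaSq (by simpa using ht')
      exact continuous_re.continuousAt.comp (ContinuousAt.comp (f := fun t : ℝ => (t : ℂ) * I + 1)
        h1 (by fun_prop))
    · have h1 : ContinuousAt thetaSq (t * I) := continuousAt_thetaSq (by simpa using ht')
      exact continuous_re.continuousAt.comp (ContinuousAt.comp (f := fun t : ℝ => (t : ℂ) * I)
        h1 (by fun_prop))
  have hlim : Tendsto (fun n : ℕ => q (2 ^ n * 1)) atTop (𝓝 1) := by
    have h := (tendsto_thetaB one_pos).div (tendsto_thetaA one_pos) one_ne_zero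
    rwa [div_one] at h
  have hs1 : √(1 - b ^ 2) < 1 := by
    rw [Real.sqrt_lt' one_pos]; nlinarith
  obtain ⟨n, hn1, hn2⟩ := ((hlim.eventually (lt_mem_nhds hb1)).and
    (hlim.eventually (lt_mem_nhds hs1))).exists
  have hT : (0 : ℝ) < 2 ^ n * 1 := by positivity
  set T : ℝ := 2 ^ n * 1
  have hinv : q (1 / T) ^ 2 = 1 - q T ^ 2 := by
    have := (thetaA_spec hT).1
    simp only [hq, div_pow]
    rw [thetaB_inv_sq hT, thetaA_inv hT]
    field_simp
  have hlt : q (1 / T) < b := by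
    have h1 : 1 - b ^ 2 < q T ^ 2 := Real.lt_sq_of_sqrt_lt hn2
    exact lt_of_pow_lt_pow_left₀ 2 hb0.le (by rw [hinv]; linarith)
  obtain ⟨t, ht, hqt⟩ := isPreconnected_Ioi.intermediate_value
    (one_div_pos.2 hT : 1 / T ∈ Set.Ioi 0)
    (hT : T ∈ Set.Ioi 0) hcont ⟨hlt.le, hn1.le⟩
  refine ⟨t, ht, ?_⟩
  have := (thetaA_spec ht).1
  rw [← hqt]
  simp only [hq]
  field_simp

end

/-- `(K(k), i K(b))` is a period basis of `(1, b)`. -/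
theorem isPeriodBasis_ellipticK {b k : ℝ} (hb0 : 0 < b) (hb1 : b < 1) (hk : k = √(1 - b ^ 2)) :
    0 < ellipticK k ∧ 0 < ellipticK b ∧
      IsPeriodBasis 1 b (ellipticK k) (I * ellipticK b) := by
  obtain ⟨t, ht, htb⟩ := exists_thetaB_eq hb0 hb1
  have hb2 : 0 < 1 - b ^ 2 := by nlinarith
  have hk0 : 0 < k := by rw [hk]; exact Real.sqrt_pos.2 hb2
  have hk2 : k ^ 2 = 1 - b ^ 2 := by rw [hk]; exact Real.sq_sqrt hb2.le
  have hA := (thetaA_spec ht).1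
  have hKk := ellipticK_eq_thetaA ht hb0 (by linarith : k ^ 2 + b ^ 2 = 1) htb
  have hB' : thetaB (1 / t) = k * thetaA (1 / t) := by
    have h1 := thetaB_inv_sq ht
    have h2 := (thetaB_spec (one_div_pos.2 ht)).1
    have h3 := (thetaA_spec (one_div_pos.2 ht)).1
    refine (sq_eq_sq₀ h2.le (by positivity)).1 ?_
    rw [h1, thetaA_inv ht, htb]
    linear_combination (-(t * thetaA t) ^ 2) * hk2
  have hKb := ellipticK_eq_thetaA (one_div_pos.2 ht) hk0 (by linarith : b ^ 2 + k ^ 2 = 1) hB'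
  rw [thetaA_inv ht] at hKb
  have hpi := Real.pi_pos
  have hpi' : (Real.pi : ℂ) ≠ 0 := by exact_mod_cast hpi.ne'
  have hA' : (thetaA t : ℂ) ≠ 0 := by exact_mod_cast hA.ne'
  have e : (I * ellipticK b / ellipticK k : ℂ) = t * I := by
    rw [hKk, hKb]; push_cast; field_simp
  have hK0 : (ellipticK k : ℂ) ≠ 0 := by
    rw [hKk]; push_cast
    exact mul_ne_zero (div_ne_zero hpi' two_ne_zero) hA'
  refine ⟨by rw [hKk]; positivity, by rw [hKb]; positivity, ?_, ?_, ?_⟩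
  · rw [e]; simpa using ht
  · rw [latticeTheta, e, (thetaA_spec ht).2, hKk]; push_cast; field_simp
  · rw [latticeTheta, add_div, e, div_self hK0, (thetaB_spec ht).2, hKk, htb]
    push_cast; field_simp

end MultivaluedAGM

/-! ### The first sign for a negative start -/

namespace MultivaluedAGM

open Complex

section

variable {a g u v : ℂ}

/-- The period basis `(u - 2εv, v)` of `(a, -g)`. -/
lemma IsPeriodBasis.shear_units (h : IsPeriodBasis a g u v) (ε : ℤˣ) :
    IsPeriodBasis a (-g) (u - 2 * ((ε : ℤ) : ℂ) * v) v := by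
  rcases Int.units_eq_one_or ε with rfl | rfl
  · simpa using h.shear'
  · simpa using h.shear

/-- The first geometric mean for the period basis `(u - 2εv, v)`. -/
lemma IsPeriodBasis.latticeTheta_shear_units (h : IsPeriodBasis a g u v) (ε : ℤˣ) :
    latticeTheta (u - 2 * ((ε : ℤ) : ℂ) * v) (2 * v + (u - 2 * ((ε : ℤ) : ℂ) * v)) =
      ((ε : ℤ) : ℂ) * (I * latticeTheta u (2 * v + u)) := by
  have hu := h.left_ne_zero
  have him : ∀ c : ℝ, 0 < c → 0 < ((u + c * v) / u).im := by
    intro c hc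
    rw [add_div, div_self hu, mul_div_assoc, add_im, im_ofReal_mul]
    have := h.im_pos
    simp; positivity
  rcases Int.units_eq_one_or ε with rfl | rfl
  · -- with `w = 2v - u`, the pair `(u - 2v, u)` is the rotation of `(u, w)`
    have h1 : 0 < ((2 * v - u) / u).im := by
      have := h.im_two_mul_pos
      rw [sub_div, div_self hu]; simpa using this
    have h2 := latticeTheta_rotate h1
    have h3 := latticeTheta_neg_neg (2 * v - u) (-u)
    have h4 := latticeTheta_add_two_mul (2 * v - u) hu
    rw [show 2 * v - u + 2 * u = 2 * v + u by ring] at h4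
    simp only [Units.val_one, Int.cast_one, mul_one, one_mul]
    rw [show 2 * v + (u - 2 * v) = - -u by ring, show u - 2 * v = -(2 * v - u) by ring, h3, h2, h4]
    ring
  · have h1 : 0 < ((u + 2 * v) / u).im := by exact_mod_cast him 2 two_pos
    have h2 := latticeTheta_rotate h1
    have hne : u + 2 * v ≠ 0 := (ne_zero_of_im_div_pos h1).2
    have h4 := latticeTheta_add_two_mul (-u) hne
    rw [h2] at h4
    simp only [Units.val_neg, Units.val_one, Int.cast_neg, Int.cast_one]
    rw [show u - 2 * -1 * v = u + 2 * v by ring,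
      show 2 * v + (u + 2 * v) = -u + 2 * (u + 2 * v) by ring, h4, add_comm (2 * v)]
    ring

end

/-- The quotient `g / a` of the `n`-th pair in the iteration that starts at a multiple of
`(θ₃(it)², -θ₄(it)²)` and follows the theta functions of the period basis `(1 - 2ε it, it)`. -/
noncomputable def shearRatio (ε : ℤˣ) (n : ℕ) (t : ℝ) : ℂ :=
  latticeTheta (1 - 2 * ((ε : ℤ) : ℂ) * (t * I))
      (2 ^ n * (t * I) + (1 - 2 * ((ε : ℤ) : ℂ) * (t * I))) /
    latticeTheta (1 - 2 * ((ε : ℤ) : ℂ) * (t * I)) (2 ^ n * (t * I))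

lemma isPeriodBasis_imaginary {t : ℝ} (ht : 0 < t) :
    IsPeriodBasis (Real.pi / 2 * thetaA t : ℝ) (Real.pi / 2 * thetaB t : ℝ) 1 (t * I) where
  im_pos := by simpa using ht
  fst_eq := by rw [latticeTheta, div_one, div_one, (thetaA_spec ht).2]; push_cast; rfl
  snd_eq := by rw [latticeTheta, div_one, div_one, (thetaB_spec ht).2]; push_cast; rfl

lemma shearRatio_ne_zero (ε : ℤˣ) (n : ℕ) {t : ℝ} (ht : 0 < t) : shearRatio ε n t ≠ 0 := by
  have h := ((isPeriodBasis_imaginary ht).shear_units ε).two_pow n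
  exact div_ne_zero h.snd_ne_zero h.fst_ne_zero

lemma shearRatio_zero_eq (ε : ℤˣ) {t : ℝ} (ht : 0 < t) :
    shearRatio ε 0 t = -((thetaB t / thetaA t : ℝ) : ℂ) := by
  have h := (isPeriodBasis_imaginary ht).shear_units ε
  have hA : (thetaA t : ℂ) ≠ 0 := by exact_mod_cast (thetaA_spec ht).1.ne'
  have hpi : (Real.pi : ℂ) ≠ 0 := by exact_mod_cast Real.pi_ne_zero
  rw [shearRatio, pow_zero, one_mul, ← h.fst_eq, ← h.snd_eq]
  push_cast; field_simp

lemma shearRatio_step (ε : ℤˣ) (n : ℕ) {t : ℝ} (ht : 0 < t) :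
    shearRatio ε (n + 1) t ^ 2 * (1 + shearRatio ε n t) ^ 2 = 4 * shearRatio ε n t := by
  have h := (isPeriodBasis_imaginary ht).shear_units ε
  have h0 := (h.two_pow n).fst_ne_zero
  have h1 := (h.two_pow (n + 1)).fst_ne_zero
  have h2 := h.snd_sq_eq n
  have h3 := h.sum_eq n
  have key : ∀ {a g A G : ℂ}, a ≠ 0 → A ≠ 0 → G ^ 2 = a * g → a + g = 2 * A →
      (G / A) ^ 2 * (1 + g / a) ^ 2 = 4 * (g / a) := by
    intro a g A G ha hA hG hs
    have e : 1 + g / a = 2 * A / a := by rw [← hs]; field_simp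
    rw [e, div_pow, hG]
    field_simp
    ring
  exact key h0 h1 h2 h3

lemma continuousOn_shearRatio (ε : ℤˣ) (n : ℕ) : ContinuousOn (shearRatio ε n) (Set.Ioi 0) := by
  intro t ht
  have ht' : 0 < t := ht
  have h := ((isPeriodBasis_imaginary ht').shear_units ε).two_pow n
  have hu := h.left_ne_zero
  set p : ℝ → ℂ := fun s => 1 - 2 * ((ε : ℤ) : ℂ) * (s * I) with hp
  have hcp : ContinuousAt p t := by fun_prop
  have aux : ∀ w : ℝ → ℂ, ContinuousAt w t → 0 < (w t / p t).im →
      ContinuousAt (fun s : ℝ => latticeTheta (p s) (w s)) t := by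
    intro w hw him
    have h1 : ContinuousAt (fun s : ℝ => thetaSq (w s / p s)) t :=
      ContinuousAt.comp (f := fun s : ℝ => w s / p s) (continuousAt_thetaSq him) (hw.div hcp hu)
    exact (continuousAt_const.mul h1).div hcp hu
  refine ContinuousAt.continuousWithinAt (ContinuousAt.div ?_ ?_ h.fst_ne_zero)
  · exact aux (fun s => 2 ^ n * (s * I) + p s) (by fun_prop) h.swap.im_pos
  · exact aux (fun s => 2 ^ n * (s * I)) (by fun_prop) h.im_pos

lemma shearRatio_re_pos_of_half (ε : ℤˣ) (n : ℕ) : 0 < (shearRatio ε (n + 2) (1 / 2)).re := by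
  have h := ((isPeriodBasis_imaginary (one_half_pos (α := ℝ))).shear_units ε).two_pow (n + 2)
  refine h.div_re_pos_of_one_le ?_
  have e : ∀ ε : ℤˣ, (((1 / 2 : ℝ) : ℂ) * I / (1 - 2 * ((ε : ℤ) : ℂ) * (((1 / 2 : ℝ) : ℂ) * I))).im
      = 1 / 4 := by
    intro ε
    rcases Int.units_eq_one_or ε with rfl | rfl <;>
      · simp [Complex.div_im, normSq_apply]
        norm_num
  rw [mul_div_assoc, im_two_pow_mul, e, pow_add]
  have : (1 : ℝ) ≤ 2 ^ n := one_le_pow₀ one_le_two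
  linarith

/-- From the second step on, the theta functions of the basis `(1 - 2ε it, it)` are near roots.
The real part of the ratio never vanishes, so that its sign does not depend on `t`, and at
`t = 1/2` the basis is high enough to see that it is positive. -/
lemma shearRatio_re_pos (ε : ℤˣ) (n : ℕ) {t : ℝ} (ht : 0 < t) :
    0 < (shearRatio ε (n + 2) t).re := by
  have step : ∀ m : ℕ, (∀ s : ℝ, 0 < s → 0 ≤ (shearRatio ε (m + 1) s).re) →
      ∀ s : ℝ, 0 < s → 0 < (shearRatio ε (m + 2) s).re := by
    intro m hm s hs
    have hne : ∀ s : ℝ, 0 < s → (shearRatio ε (m + 2) s).re ≠ 0 := fun s hs =>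
      re_ne_zero_of_re_nonneg (shearRatio_ne_zero ε (m + 1) hs) (hm s hs)
        (shearRatio_step ε (m + 1) hs)
    by_contra! hcon
    obtain ⟨r, hr, hr0⟩ := isPreconnected_Ioi.intermediate_value (hs : s ∈ Set.Ioi 0)
      (Set.mem_Ioi.2 one_half_pos : (1 / 2 : ℝ) ∈ Set.Ioi 0)
      (continuous_re.comp_continuousOn (continuousOn_shearRatio ε (m + 2)))
      ⟨hcon, (shearRatio_re_pos_of_half ε m).le⟩
    exact hne r hr hr0
  have base : ∀ s : ℝ, 0 < s → 0 ≤ (shearRatio ε (0 + 1) s).re := by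
    intro s hs
    have h := shearRatio_step ε 0 hs
    rw [shearRatio_zero_eq ε hs] at h
    set x : ℝ := thetaB s / thetaA s with hx
    have hx0 : 0 < x := div_pos (thetaB_spec hs).1 (thetaA_spec hs).1
    set w := shearRatio ε (0 + 1) s
    have h1 : w ^ 2 * (((1 - x) ^ 2 : ℝ) : ℂ) = ((-(4 * x) : ℝ) : ℂ) := by
      push_cast; linear_combination h
    -- the square of the first ratio is real and negative
    have hre := congrArg re h1
    have him := congrArg im h1
    rw [re_mul_ofReal, ofReal_re] at hre
    rw [im_mul_ofReal, ofReal_im] at him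
    have hne : (1 - x) ^ 2 ≠ 0 := by
      intro h0; rw [h0] at hre; linarith
    have him' := (mul_eq_zero.1 him).resolve_right hne
    rw [sq] at him' hre
    simp only [mul_im, mul_re] at him' hre
    by_contra! hcon
    have hi : w.im = 0 := by
      have : w.re * w.im = 0 := by linarith
      exact (mul_eq_zero.1 this).resolve_left hcon.ne
    rw [hi] at hre
    nlinarith [mul_nonneg (mul_self_nonneg w.re) (sq_nonneg (1 - x))]
  have main : ∀ m : ℕ, ∀ s : ℝ, 0 < s → 0 < (shearRatio ε (m + 2) s).re := by
    intro m
    induction m with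
    | zero => exact step 0 base
    | succ m ih => exact step (m + 1) fun s hs => (ih s hs).le
  exact main n t ht

lemma latticeTheta_smul (c u v : ℂ) (hc : c ≠ 0) :
    latticeTheta (c * u) (c * v) = c⁻¹ * latticeTheta u v := by
  rw [latticeTheta, latticeTheta, mul_div_mul_left _ _ hc]
  field_simp

/-- The near root of `-b` is `i √b`, by the tie rule. -/
lemma nearRoot_one_neg {b : ℝ} (hb0 : 0 < b) : nearRoot 1 (-(b : ℂ)) = I * (√b : ℝ) := by
  have hsq : (I * (√b : ℝ) : ℂ) ^ 2 = 1 * -(b : ℂ) := by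
    rw [mul_pow, I_sq, ← ofReal_pow, Real.sq_sqrt hb0.le]; ring
  have hre : ((I * (√b : ℝ) : ℂ) / (1 + -(b : ℂ))).re = 0 := by
    rw [show (1 + -(b : ℂ)) = ((1 - b : ℝ) : ℂ) by push_cast; ring, div_ofReal_re]; simp
  rcases eq_nearRoot_or_eq_neg hsq with h | h
  · exact h.symm
  · exfalso
    have h' : nearRoot 1 (-(b : ℂ)) = -(I * (√b : ℝ)) := by rw [h, neg_neg]
    have h1 := nearRoot_im_nonneg_of_tie (a := 1) (g := -(b : ℂ)) (by
      rw [h', neg_div, neg_re, hre, neg_zero])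
    rw [h'] at h1
    have := Real.sqrt_pos.2 hb0
    simp at h1
    linarith

/-- The mean of `1` and `-b` with first sign `ε` and near roots afterwards belongs to the period
basis `(K(k) - 2ε i K(b), i K(b))`. -/
lemma hasAGM_neg {b k : ℝ} (hb0 : 0 < b) (hb1 : b < 1) (hk : k = √(1 - b ^ 2)) (ε : ℤˣ) :
    HasAGM (Function.update 1 0 ε) 1 (-(b : ℂ))
      (Real.pi / (2 * (ellipticK k - 2 * ((ε : ℤ) : ℂ) * (I * ellipticK b)))) := by
  obtain ⟨hK, hK', h⟩ := isPeriodBasis_ellipticK hb0 hb1 hk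
  have hKne : (ellipticK k : ℂ) ≠ 0 := by exact_mod_cast hK.ne'
  have hs := h.shear_units ε
  refine hs.hasAGM_of_signs fun n => ?_
  rcases n with _ | n
  · rw [pow_zero, one_mul, ← hs.fst_eq, ← hs.snd_eq, zero_add, pow_one, Function.update_self,
      h.latticeTheta_shear_units ε, nearRoot_one_neg hb0]
    congr 2
    -- both sides are the positive square root of `b`
    have hm := h.mul_eq
    have ht : 0 < 2 * (ellipticK b / ellipticK k) := by positivity
    have e : latticeTheta (ellipticK k) (2 * (I * ellipticK b) + ellipticK k) =
        ((Real.pi / 2 * thetaB (2 * (ellipticK b / ellipticK k)) / ellipticK k : ℝ) : ℂ) := by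
      rw [latticeTheta, add_div, div_self hKne, show (2 * (I * ellipticK b) / ellipticK k : ℂ) =
        ((2 * (ellipticK b / ellipticK k) : ℝ) : ℂ) * I by push_cast; ring, (thetaB_spec ht).2]
      push_cast; rfl
    rw [e] at hm ⊢
    have hB := (thetaB_spec ht).1
    have hm' : b = (Real.pi / 2 * thetaB (2 * (ellipticK b / ellipticK k)) / ellipticK k) ^ 2 := by
      rw [one_mul] at hm
      exact_mod_cast hm
    congr 1
    have hpos : 0 ≤ Real.pi / 2 * thetaB (2 * (ellipticK b / ellipticK k)) / ellipticK k := by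
      have := Real.pi_pos
      positivity
    exact ((Real.sqrt_eq_iff_mul_self_eq hb0.le hpos).2 (by rw [← sq]; exact hm')).symm
  · rw [Function.update_of_ne (by omega), Pi.one_apply, Units.val_one, Int.cast_one, one_mul,
      hs.nearRoot_eq]
    have ht : 0 < ellipticK b / ellipticK k := by positivity
    have hpos := shearRatio_re_pos ε n ht
    set t := ellipticK b / ellipticK k with htdef
    have e1 : (I * ellipticK b : ℂ) = ellipticK k * (t * I) := by
      rw [htdef]; push_cast; field_simp
    have e2 : (ellipticK k - 2 * ((ε : ℤ) : ℂ) * (I * ellipticK b) : ℂ) =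
        ellipticK k * (1 - 2 * ((ε : ℤ) : ℂ) * (t * I)) := by rw [e1]; ring
    rw [e2, e1, show (2 : ℂ) ^ (n + 1 + 1) * (ellipticK k * (t * I)) =
      ellipticK k * (2 ^ (n + 2) * (t * I)) by ring, ← mul_add, latticeTheta_smul _ _ _ hKne,
      latticeTheta_smul _ _ _ hKne, mul_div_mul_left _ _ (inv_ne_zero hKne)]
    exact hpos

/-! ### Lattices spanned by the values -/

/-- A lattice through a point as an affine subspace over the integers. -/
def latticeSubspace (z ω₁ ω₂ : ℂ) : AffineSubspace ℤ ℂ where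
  carrier := latticeThrough z ω₁ ω₂
  smul_vsub_vadd_mem' := by
    rintro c p₁ p₂ p₃ ⟨m₁, n₁, rfl⟩ ⟨m₂, n₂, rfl⟩ ⟨m₃, n₃, rfl⟩
    refine ⟨c * (m₁ - m₂) + m₃, c * (n₁ - n₂) + n₃, ?_⟩
    simp only [vsub_eq_sub, vadd_eq_add, zsmul_eq_mul]
    push_cast; ring

/-- A subset of a lattice spans it once it has three points whose differences generate it. -/
lemma affineSpan_eq_latticeThrough {S : Set ℂ} {z ω₁ ω₂ p₀ p₁ p₂ : ℂ}
    (hS : S ⊆ latticeThrough z ω₁ ω₂) (h₀ : p₀ ∈ S) (h₁ : p₁ ∈ S) (h₂ : p₂ ∈ S)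
    (h : ∀ m n : ℤ, ∃ m' n' : ℤ,
      z + m * ω₁ + n * ω₂ = p₀ + m' * (p₁ - p₀) + n' * (p₂ - p₀)) :
    (affineSpan ℤ S : Set ℂ) = latticeThrough z ω₁ ω₂ := by
  apply Set.Subset.antisymm
  · have : affineSpan ℤ S ≤ latticeSubspace z ω₁ ω₂ := affineSpan_le.2 hS
    exact this
  · rintro w ⟨m, n, rfl⟩
    obtain ⟨m', n', e⟩ := h m n
    have hs := subset_affineSpan ℤ S
    have h3 := AffineSubspace.smul_vsub_vadd_mem (affineSpan ℤ S) m' (hs h₁) (hs h₀) (hs h₀)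
    have h4 := AffineSubspace.smul_vsub_vadd_mem (affineSpan ℤ S) n' (hs h₂) (hs h₀) h3
    simp only [vsub_eq_sub, vadd_eq_add, zsmul_eq_mul] at h4
    rw [e, SetLike.mem_coe]
    convert h4 using 1
    ring

/-- The values lie in the coset `u + 4 (ℤ u + ℤ v)` of a period basis `(u, v)`. -/
lemma IsPeriodBasis.eq_of_mem {x u v w : ℂ} (h : IsPeriodBasis 1 x u v)
    (hw : w ∈ invAGMValues x) : ∃ d c : ℤ, 4 ∣ d - 1 ∧ 4 ∣ c ∧ w = d * u + c * v := by
  obtain ⟨σ, hσ, M, -, hM, rfl⟩ := hw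
  obtain ⟨d, c, hd, hc, hne, hM'⟩ := h.exists_hasAGM hσ
  refine ⟨d, c, hd, hc, ?_⟩
  have hpi : (Real.pi : ℂ) ≠ 0 := by exact_mod_cast Real.pi_ne_zero
  rw [hM.unique hM']
  field_simp

lemma IsPeriodBasis.swap_shear_swap {a g u v : ℂ} (h : IsPeriodBasis a g u v) :
    IsPeriodBasis a g (5 * u + 4 * v) (6 * u + 5 * v) := by
  have h1 := h.swap.shear_four.swap
  rwa [show u + 4 * (v + u) = 5 * u + 4 * v by ring,
    show v + u + (5 * u + 4 * v) = 6 * u + 5 * v by ring] at h1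

lemma norm_sq_add_mul_I (K K' : ℝ) (d c : ℤ) :
    ‖(d : ℂ) * K + c * (I * K')‖ ^ 2 = (d * K) ^ 2 + (c * K') ^ 2 := by
  rw [← normSq_eq_norm_sq, normSq_apply]
  simp
  ring

/-- Since `d ≡ 1` modulo `4` has `d² ≥ 1`, with equality for `d = 1` only, the points
`d K + c i K'` with `c² ≥ c₀²` are at least as far from `0` as `K + c₀ i K'`. -/
lemma norm_minimal {K K' : ℝ} (hK : 0 < K) (hK' : 0 < K') {d c c₀ : ℤ} (hd : 4 ∣ d - 1)
    (hc : c₀ ^ 2 ≤ c ^ 2) :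
    ‖((1 : ℤ) : ℂ) * K + c₀ * (I * K')‖ ≤ ‖(d : ℂ) * K + c * (I * K')‖ ∧
      (‖(d : ℂ) * K + c * (I * K')‖ ≤ ‖((1 : ℤ) : ℂ) * K + c₀ * (I * K')‖ →
        d = 1 ∧ c ^ 2 = c₀ ^ 2) := by
  have hd1 : 1 ≤ d ^ 2 := by
    have : d ≠ 0 := by omega
    have := sq_pos_of_ne_zero this
    omega
  have hd1' : (1 : ℝ) ≤ (d : ℝ) ^ 2 := by exact_mod_cast hd1
  have hc' : (c₀ : ℝ) ^ 2 ≤ (c : ℝ) ^ 2 := by exact_mod_cast hc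
  have e1 := norm_sq_add_mul_I K K' d c
  have e2 := norm_sq_add_mul_I K K' 1 c₀
  push_cast at e2
  have h1 : K ^ 2 ≤ (d : ℝ) ^ 2 * K ^ 2 := by nlinarith [sq_nonneg K]
  have h2 : (c₀ : ℝ) ^ 2 * K' ^ 2 ≤ (c : ℝ) ^ 2 * K' ^ 2 := by gcongr
  push_cast
  constructor
  · refine le_of_sq_le_sq ?_ (norm_nonneg _)
    rw [e1, e2]; nlinarith
  · intro hle
    have hle2 := pow_le_pow_left₀ (norm_nonneg _) hle 2
    rw [e1, e2] at hle2
    have h3 : (d : ℝ) ^ 2 * K ^ 2 = 1 * K ^ 2 := by nlinarith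
    have h4 : (c : ℝ) ^ 2 * K' ^ 2 = (c₀ : ℝ) ^ 2 * K' ^ 2 := by nlinarith
    have h5 := mul_right_cancel₀ (by positivity : K ^ 2 ≠ 0) h3
    have h6 := mul_right_cancel₀ (by positivity : K' ^ 2 ≠ 0) h4
    have h7 : d ^ 2 = 1 := by exact_mod_cast h5
    refine ⟨?_, by exact_mod_cast h6⟩
    rcases (sq_eq_sq_iff_eq_or_eq_neg.1 (h7.trans (one_pow 2).symm)) with h | h <;> omega

end MultivaluedAGM

/-! ### The values from `b` and from `-b` -/

/-- Here `affineSpan ℤ S` is the smallest translate of an additive subgroup of `ℂ` containing `S`,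
that is, the (possibly offset) lattice which the points of `S` span. The sign `ε` in the first part
is the choice of the first root `√(-b) = ε i √b`; all later roots are the near ones. -/
theorem mainTheorem1 (b k : ℝ) (hb0 : 0 < b) (hb1 : b < 1) (hk : k = Real.sqrt (1 - b ^ 2)) :
    -- the two values from `-b`
    (∀ ε : ℤˣ, ∃ M : ℂ, M ≠ 0 ∧
      MultivaluedAGM.HasAGM (Function.update 1 0 ε) 1 (-(b : ℂ)) M ∧
      (Real.pi : ℂ) / (2 * M) =
        (MultivaluedAGM.ellipticK k : ℂ)
          - ((ε : ℤ) : ℂ) * (2 * Complex.I * (MultivaluedAGM.ellipticK b : ℂ))) ∧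
    -- the AGM exists and is nonzero for all admissible sign choices, from `b` and from `-b`
    (∀ σ : ℕ → ℤˣ, MultivaluedAGM.FinitelyManyFlips σ →
      (∃ M : ℂ, M ≠ 0 ∧ MultivaluedAGM.HasAGM σ 1 (b : ℂ) M) ∧
      (∃ M : ℂ, M ≠ 0 ∧ MultivaluedAGM.HasAGM σ 1 (-(b : ℂ)) M)) ∧
    -- the lattice from `b`, through `K(k)`
    ((affineSpan ℤ (MultivaluedAGM.invAGMValues (b : ℂ)) : Set ℂ) =
      MultivaluedAGM.latticeThrough (MultivaluedAGM.ellipticK k : ℂ)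
        (4 * (MultivaluedAGM.ellipticK k : ℂ))
        (4 * Complex.I * (MultivaluedAGM.ellipticK b : ℂ))) ∧
    -- the lattice from `-b`, offset by `2 i K(b)`
    ((affineSpan ℤ (MultivaluedAGM.invAGMValues (-(b : ℂ))) : Set ℂ) =
      MultivaluedAGM.latticeThrough
        ((MultivaluedAGM.ellipticK k : ℂ)
          + 2 * Complex.I * (MultivaluedAGM.ellipticK b : ℂ))
        (4 * (MultivaluedAGM.ellipticK k : ℂ))
        (4 * Complex.I * (MultivaluedAGM.ellipticK b : ℂ))) ∧
    -- the smallest values from `b` and from `-b`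
    (MultivaluedAGM.smallestElements (MultivaluedAGM.invAGMValues (b : ℂ)) =
      {(MultivaluedAGM.ellipticK k : ℂ)}) ∧
    (MultivaluedAGM.smallestElements (MultivaluedAGM.invAGMValues (-(b : ℂ))) =
      {(MultivaluedAGM.ellipticK k : ℂ)
          - 2 * Complex.I * (MultivaluedAGM.ellipticK b : ℂ),
        (MultivaluedAGM.ellipticK k : ℂ)
          + 2 * Complex.I * (MultivaluedAGM.ellipticK b : ℂ)}) := by
  obtain ⟨hK, hK', hb⟩ := MultivaluedAGM.isPeriodBasis_ellipticK hb0 hb1 hk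
  set u : ℂ := (MultivaluedAGM.ellipticK k : ℂ) with hu
  set y : ℂ := (MultivaluedAGM.ellipticK b : ℂ) with hy
  have hne : ∀ z : ℂ, z ≠ 0 → (Real.pi : ℂ) / (2 * z) ≠ 0 := fun z hz =>
    div_ne_zero (by exact_mod_cast Real.pi_ne_zero) (mul_ne_zero two_ne_zero hz)
  have hpi : (Real.pi : ℂ) ≠ 0 := by exact_mod_cast Real.pi_ne_zero
  have hp := hb.shear
  have hm := hb.shear'
  -- `V(b)` and `V(-b)` lie in the two cosets
  have hVb : ∀ w ∈ MultivaluedAGM.invAGMValues (b : ℂ), ∃ m n : ℤ,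
      w = (1 + 4 * m : ℤ) * u + (4 * n : ℤ) * (Complex.I * y) := by
    intro w hw
    obtain ⟨d, c, ⟨m, hd⟩, ⟨n, hc⟩, rfl⟩ := hb.eq_of_mem hw
    exact ⟨m, n, by rw [← hd, ← hc, add_sub_cancel]⟩
  have hVnb : ∀ w ∈ MultivaluedAGM.invAGMValues (-(b : ℂ)), ∃ m n : ℤ,
      w = (1 + 4 * m : ℤ) * u + (2 + 4 * n : ℤ) * (Complex.I * y) := by
    intro w hw
    obtain ⟨d, c, ⟨m, hd⟩, ⟨n, hc⟩, rfl⟩ := hp.eq_of_mem hw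
    refine ⟨m, n + 2 * m, ?_⟩
    obtain rfl : d = 1 + 4 * m := by omega
    rw [hc]; push_cast; ring
  have h1 : u ∈ MultivaluedAGM.invAGMValues (b : ℂ) := hb.mem_invAGMValues
  have h2 := hp.mem_invAGMValues
  have h3 := hm.mem_invAGMValues
  refine ⟨?_, ?_, ?_, ?_, ?_, ?_⟩
  · intro ε
    have h0 := (hb.shear_units ε).left_ne_zero
    refine ⟨_, hne _ h0, MultivaluedAGM.hasAGM_neg hb0 hb1 hk ε, ?_⟩
    rw [mul_div_assoc', mul_div_mul_left _ _ two_ne_zero, div_div_cancel₀ hpi]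
    ring
  · intro σ hσ
    constructor
    · obtain ⟨d, c, -, -, h0, hM⟩ := hb.exists_hasAGM hσ
      exact ⟨_, hne _ h0, hM⟩
    · obtain ⟨d, c, -, -, h0, hM⟩ := hp.exists_hasAGM hσ
      exact ⟨_, hne _ h0, hM⟩
  · -- the points `u`, `u + 4v`, `5u + 4v` with `u = K(k)`, `v = i K(b)`
    refine MultivaluedAGM.affineSpan_eq_latticeThrough ?_ h1 hb.shear_four.mem_invAGMValues
      hb.swap_shear_swap.mem_invAGMValues fun m n => ⟨n - m, m, by push_cast; ring⟩
    intro w hw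
    obtain ⟨m, n, rfl⟩ := hVb w hw
    exact ⟨m, n, by push_cast; ring⟩
  · -- the points `u + 2v`, `u - 2v`, `5(u + 2v) + 4v`
    refine MultivaluedAGM.affineSpan_eq_latticeThrough ?_ h2 h3
      hp.swap_shear_swap.mem_invAGMValues fun m n => ⟨3 * m - n, m, by push_cast; ring⟩
    intro w hw
    obtain ⟨m, n, rfl⟩ := hVnb w hw
    exact ⟨m, n, by push_cast; ring⟩
  · have hd4 : ∀ m : ℤ, 4 ∣ 1 + 4 * m - 1 := fun m => by omega
    have hsq : ∀ n : ℤ, (0 : ℤ) ^ 2 ≤ (4 * n) ^ 2 := fun n => by simpa using sq_nonneg (4 * n)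
    have e0 : u = ((1 : ℤ) : ℂ) * u + (0 : ℤ) * (Complex.I * y) := by push_cast; ring
    ext w
    simp only [Set.mem_singleton_iff]
    constructor
    · rintro ⟨hw, hle⟩
      obtain ⟨m, n, rfl⟩ := hVb w hw
      have hle' := (hle u h1).trans_eq (congrArg norm e0)
      obtain ⟨hd, hc⟩ := (MultivaluedAGM.norm_minimal hK hK' (hd4 m) (hsq n)).2 hle'
      rw [sq_eq_sq_iff_eq_or_eq_neg, neg_zero, or_self] at hc
      rw [hd, hc, ← e0]
    · rintro rfl
      refine ⟨h1, fun z hz => ?_⟩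
      obtain ⟨m, n, rfl⟩ := hVb z hz
      exact (congrArg norm e0).trans_le (MultivaluedAGM.norm_minimal hK hK' (hd4 m) (hsq n)).1
  · have e1 : u + 2 * Complex.I * y = ((1 : ℤ) : ℂ) * u + (2 : ℤ) * (Complex.I * y) := by
      push_cast; ring
    have e2 : u - 2 * Complex.I * y = ((1 : ℤ) : ℂ) * u + (-2 : ℤ) * (Complex.I * y) := by
      push_cast; ring
    rw [← mul_assoc, e1] at h2
    rw [← mul_assoc, e2] at h3
    have hsq : ∀ n : ℤ, 4 ≤ (2 + 4 * n) ^ 2 := by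
      intro n
      have : 0 ≤ n * (n + 1) := by
        rcases le_or_gt 0 n with hn | hn
        · positivity
        · exact mul_nonneg_of_nonpos_of_nonpos hn.le (by omega)
      nlinarith
    rw [e1, e2]
    ext w
    simp only [Set.mem_insert_iff, Set.mem_singleton_iff]
    constructor
    · rintro ⟨hw, hle⟩
      obtain ⟨m, n, rfl⟩ := hVnb w hw
      obtain ⟨hd, hc⟩ := (MultivaluedAGM.norm_minimal hK hK' (by omega)
        (by simpa using hsq n)).2 (hle _ h2)
      rcases sq_eq_sq_iff_eq_or_eq_neg.1 hc with hc | hc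
      · right; rw [hd, hc]
      · left; rw [hd, hc]
    · rintro (rfl | rfl)
      · refine ⟨h3, fun z hz => ?_⟩
        obtain ⟨m, n, rfl⟩ := hVnb z hz
        exact (MultivaluedAGM.norm_minimal hK hK' (by omega) (by simpa using hsq n)).1
      · refine ⟨h2, fun z hz => ?_⟩
        obtain ⟨m, n, rfl⟩ := hVnb z hz
        exact (MultivaluedAGM.norm_minimal hK hK' (by omega) (by simpa using hsq n)).1
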